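/- Let $d\ge 1$, let $A,B$ be $d$-dimensional quantum systems with fixed (incoherent) orthonormal bases $\{|i\rangle\}_{i=0}^{d-1}$, and use the product basis on $AB$ and on systems enlarged by ancillas. Let $\Delta$ be the dephasing channel $\Delta(X)=\sum_i\langle i|X|i\rangle\,|i\rangle\langle i|$ of the system in question. A channel (completely positive trace-preserving map) $\mathcal F$ is detection-incoherent ($\mathcal F\in\mathrm{DIO}$) if $\Delta\circ\mathcal F=\Delta\circ\mathcal F\circ\Delta$, and unital if $\mathcal F(I)=I$. A measurement $\mathcal M=\{M_x\}_x$ is a finite POVM with any number of outcomes; it is incoherent ($\mathcal M\in\mathrm{IM}$) if $\Delta(M_x)=M_x$ for all $x$; and $\mathcal M\circ\mathcal E$ is the measurement $\{\mathcal E^\dagger(M_x)\}_x$. For measurements on a system of dimension $D$ put $D_m(\mathcal M\Vert\mathcal N)=\frac1D\sum_x D(M_x\Vert N_x)$, where $D(X\Vert Y)=\operatorname{tr}X\log X-\operatorname{tr}X\log Y$ if $\operatorname{supp}X\subseteq\operatorname{supp}Y$ and $D(X\Vert Y)=+\infty$ otherwise. Let $\overline{\mathrm{LOCC}}$ and $\overline{\mathrm{LOCC}}_M$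 be the closures of the sets of LOCC channels (finite compositions of one-way LOCC rounds) and of LOCC measurements. For a channel $\mathcal E_A$ on $A$ and a channel $\mathcal E_{AB}$ on $AB$ define $$C(\mathcal E_A)=\min_{\mathcal F_A\in\mathrm{DIO}}\ \max_{\mathcal M_{A\widetilde A}\in\mathrm{IM}}D_m(\mathcal M_{A\widetilde A}\circ\mathcal E_A\Vert\mathcal M_{A\widetilde A}\circ\mathcal F_A),$$ $$E(\mathcal E_{AB})=\min_{\mathcal F_{AB}\in\overline{\mathrm{LOCC}}(A:B)}\ \max_{\mathcal M\in\overline{\mathrm{LOCC}}_M(A\widetilde A:B\widetilde B)}D_m(\mathcal M\circ\mathcal E_{AB}\Vert\mathcal M\circ\mathcal F_{AB}),$$ where the ancillas $\widetilde A,\widetilde B$ have arbitrary finite dimension $\geq 1$, identity channels are omitted, and $\min$, $\max$ are read as infimum and supremum in $[-\infty,+\infty]$. Let $U_{\mathrm{CNOT}}=\sum_{i,j=0}^{d-1}|i,i\oplus j\rangle\langle i,j|$, with $\oplus$ addition modulo $d$, and $\mathcal U_{\mathrm{CNOT}}^\dagger(X)=U_{\mathrm{CNOT}}^\dagger X U_{\mathrm{CNOT}}$.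 Then for every channel $\mathcal E_A$ on $A$, $$E(\Delta_{AB}\circ\mathcal E_A\circ\mathcal U_{\mathrm{CNOT}}^\dagger)=C(\mathcal E_A),$$ the channel $\mathcal U_{\mathrm{CNOT}}^\dagger$ on $AB$ is a unital detection-incoherent channel, and $$C(\mathcal E_A)=\max_{\mathcal K_{AB},\mathcal L_{AB}}E(\Delta_{AB}\circ\mathcal K_{AB}\circ\mathcal E_A\circ\mathcal L_{AB}),$$ where $\mathcal K_{AB}$ runs over the detection-incoherent channels on $AB$ and $\mathcal L_{AB}$ over the unital detection-incoherent channels on $AB$, and the maximum is attained. -/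

import Mathlib

open scoped Matrix Kronecker ComplexOrder

noncomputable section

namespace MeasRes

/-! A finite type `m` indexes the incoherent orthonormal basis of a quantum system of
dimension `Fintype.card m`; a composite system is indexed by the product type. -/

/-- Operators on the system with incoherent basis indexed by `m`. -/
abbrev Op (m : Type) := Matrix m m ℂ

/-- Linear maps taking operators on `m` to operators on `n`. -/
abbrev SuperOp (m n : Type) := Op m →ₗ[ℂ] Op n

section Channels

variable {m n : Type}

/-- `Φ ⊗ id` on a system with an ancilla `κ` on the right. -/
def ampRight (Φ : SuperOp m n) (κ : Type) : SuperOp (m × κ) (n × κ) where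
  toFun X := Matrix.of fun p q =>
    Φ (Matrix.of fun i j => X (i, p.2) (j, q.2)) p.1 q.1
  map_add' X Y := by
    ext p q
    exact congrFun (congrFun (Φ.map_add (Matrix.of fun i j => X (i, p.2) (j, q.2))
      (Matrix.of fun i j => Y (i, p.2) (j, q.2))) p.1) q.1
  map_smul' c X := by
    ext p q
    exact congrFun (congrFun (Φ.map_smul c
      (Matrix.of fun i j => X (i, p.2) (j, q.2))) p.1) q.1

/-- `id ⊗ Φ` on a system with an ancilla `κ` on the left. -/
def ampLeft (κ : Type) (Φ : SuperOp m n) : SuperOp (κ × m) (κ × n) where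
  toFun X := Matrix.of fun p q =>
    Φ (Matrix.of fun i j => X (p.1, i) (q.1, j)) p.2 q.2
  map_add' X Y := by
    ext p q
    exact congrFun (congrFun (Φ.map_add (Matrix.of fun i j => X (p.1, i) (q.1, j))
      (Matrix.of fun i j => Y (p.1, i) (q.1, j))) p.2) q.2
  map_smul' c X := by
    ext p q
    exact congrFun (congrFun (Φ.map_smul c
      (Matrix.of fun i j => X (p.1, i) (q.1, j))) p.2) q.2

/-- The tensor product `Φ ⊗ Ψ` of two maps. -/
def tensor {m' n' : Type} (Φ : SuperOp m m') (Ψ : SuperOp n n') :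
    SuperOp (m × n) (m' × n') :=
  ampRight Φ n' ∘ₗ ampLeft m Ψ

/-- For `Φ` on a bipartite system `AB` and ancillas `S`, `T`, the map `Φ ⊗ id` on the system
`AS : BT`, the factors being ordered as `(A × S) × (B × T)`. -/
def ampBipartite {A B A' B' : Type} (Φ : SuperOp (A × B) (A' × B')) (S T : Type) :
    SuperOp ((A × S) × (B × T)) ((A' × S) × (B' × T)) where
  toFun X := Matrix.of fun p q =>
    Φ (Matrix.of fun i j => X ((i.1, p.1.2), (i.2, p.2.2)) ((j.1, q.1.2), (j.2, q.2.2)))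
      (p.1.1, p.2.1) (q.1.1, q.2.1)
  map_add' X Y := by
    ext p q
    exact congrFun (congrFun (Φ.map_add
      (Matrix.of fun i j => X ((i.1, p.1.2), (i.2, p.2.2)) ((j.1, q.1.2), (j.2, q.2.2)))
      (Matrix.of fun i j => Y ((i.1, p.1.2), (i.2, p.2.2)) ((j.1, q.1.2), (j.2, q.2.2))))
      (p.1.1, p.2.1)) (q.1.1, q.2.1)
  map_smul' c X := by
    ext p q
    exact congrFun (congrFun (Φ.map_smul c
      (Matrix.of fun i j => X ((i.1, p.1.2), (i.2, p.2.2)) ((j.1, q.1.2), (j.2, q.2.2))))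
      (p.1.1, p.2.1)) (q.1.1, q.2.1)

/-- Complete positivity: `Φ ⊗ id_k` preserves positive semidefiniteness for every `k`. -/
def IsCP (Φ : SuperOp m n) : Prop :=
  ∀ (k : ℕ) (X : Op (m × Fin k)), X.PosSemidef → (ampRight Φ (Fin k) X).PosSemidef

/-- Trace preservation. -/
def IsTP [Fintype m] [Fintype n] (Φ : SuperOp m n) : Prop :=
  ∀ X : Op m, (Φ X).trace = X.trace

/-- Quantum channels: completely positive and trace-preserving linear maps. -/
def IsChannel [Fintype m] [Fintype n] (Φ : SuperOp m n) : Prop :=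
  IsCP Φ ∧ IsTP Φ

/-- The adjoint (Heisenberg-picture) map `Φ†`, determined by
`tr (Φ† Y * X) = tr (Y * Φ X)`; see `trace_dual_mul`. -/
def dual [Fintype n] [DecidableEq m] (Φ : SuperOp m n) (Y : Op n) : Op m :=
  Matrix.of fun i j => (Y * Φ (Matrix.single j i 1)).trace

theorem trace_dual_mul [Fintype m] [Fintype n] [DecidableEq m] (Φ : SuperOp m n)
    (Y : Op n) (X : Op m) : (dual Φ Y * X).trace = (Y * Φ X).trace := by
  conv_rhs => rw [Matrix.matrix_eq_sum_single X]
  have h : ∀ i j : m, Matrix.single i j (X i j) = X i j • Matrix.single i j (1 : ℂ) := by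
    intro i j
    simp [Matrix.smul_single]
  simp only [h, map_sum, map_smul, Finset.mul_sum, Matrix.trace_sum, Matrix.mul_smul,
    Matrix.trace_smul, smul_eq_mul]
  rw [Finset.sum_comm, Matrix.trace]
  refine Finset.sum_congr rfl fun i _ => ?_
  rw [Matrix.diag_apply, Matrix.mul_apply]
  exact Finset.sum_congr rfl fun j _ => mul_comm _ _

/-- The dephasing channel `Δ` in the incoherent basis. -/
def dephase (m : Type) [DecidableEq m] : SuperOp m m where
  toFun X := Matrix.diagonal fun i => X i i
  map_add' X Y := by
    ext i j
    by_cases h : i = j <;> simp [Matrix.diagonal, h]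
  map_smul' c X := by
    ext i j
    by_cases h : i = j <;> simp [Matrix.diagonal, h]

/-- Detection-incoherent operations: channels `Φ` with `Δ ∘ Φ = Δ ∘ Φ ∘ Δ`. -/
def IsDIO [Fintype m] [DecidableEq m] (Φ : SuperOp m m) : Prop :=
  IsChannel Φ ∧ dephase m ∘ₗ Φ = dephase m ∘ₗ Φ ∘ₗ dephase m

/-- Unitality: `Φ(I) = I`. -/
def IsUnital [DecidableEq m] (Φ : SuperOp m m) : Prop :=
  Φ 1 = 1

/-- The map `X ↦ V X V†`. -/
def conjBy [Fintype m] (V : Op m) : SuperOp m m where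
  toFun X := V * X * Vᴴ
  map_add' X Y := by rw [Matrix.mul_add, Matrix.add_mul]
  map_smul' c X := by simp

end Channels

section Measurements

variable {m : Type} [Fintype m] [DecidableEq m]

/-- Positive operator valued measures with `r` outcomes. -/
def IsPOVM {r : ℕ} (M : Fin r → Op m) : Prop :=
  (∀ x, (M x).PosSemidef) ∧ ∑ x, M x = 1

/-- Incoherent measurements: all POVM elements are fixed by dephasing. -/
def IsIncoherentMeas {r : ℕ} (M : Fin r → Op m) : Prop :=
  IsPOVM M ∧ ∀ x, dephase m (M x) = M x

/-- The measurement `M ∘ Φ`: its POVM elements are `Φ†(M x)`. -/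
def preprocess {n : Type} [Fintype n] {r : ℕ} (M : Fin r → Op n) (Φ : SuperOp m n) :
    Fin r → Op m :=
  fun x => dual Φ (M x)

open Classical in
/-- Quantum relative entropy `D(X‖Y) = tr (X log X) - tr (X log Y)` of positive semidefinite
`X`, `Y` if `ker Y ⊆ ker X` (that is, `supp X ⊆ supp Y`), and `+∞` otherwise. The logarithm is
applied to eigenvalues, and `Real.log 0 = 0` gives the convention `0 log 0 = 0`. -/
def relEntropy (X Y : Op m) : EReal :=
  if ∀ v : m → ℂ, Y *ᵥ v = 0 → X *ᵥ v = 0 then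
    (((X * cfc Real.log X).trace.re - (X * cfc Real.log Y).trace.re : ℝ) : EReal)
  else ⊤

/-- Measurement relative entropy `D_m(M‖N) = (1 / dim) ∑ x, D(M x‖N x)`. -/
def measRelEntropy {r : ℕ} (M N : Fin r → Op m) : EReal :=
  ((1 / (Fintype.card m : ℝ) : ℝ) : EReal) * ∑ x, relEntropy (M x) (N x)

end Measurements

section LOCC

/-- One round of local operations with classical communication from the first party to the
second: an instrument `Φ` of the first party, and channels `Ψ a` of the second party chosen
according to the outcome `a`. -/
def IsOneWayRight {A B A' B' : Type} [Fintype A] [Fintype B] [Fintype A'] [Fintype B']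
    (Λ : SuperOp (A × B) (A' × B')) : Prop :=
  ∃ (r : ℕ) (Φ : Fin r → SuperOp A A') (Ψ : Fin r → SuperOp B B'),
    (∀ a, IsCP (Φ a)) ∧ IsTP (∑ a, Φ a) ∧ (∀ a, IsChannel (Ψ a)) ∧
      Λ = ∑ a, tensor (Φ a) (Ψ a)

/-- One round with classical communication from the second party to the first. -/
def IsOneWayLeft {A B A' B' : Type} [Fintype A] [Fintype B] [Fintype A'] [Fintype B']
    (Λ : SuperOp (A × B) (A' × B')) : Prop :=
  ∃ (r : ℕ) (Φ : Fin r → SuperOp A A') (Ψ : Fin r → SuperOp B B'),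
    (∀ a, IsChannel (Φ a)) ∧ (∀ a, IsCP (Ψ a)) ∧ IsTP (∑ a, Ψ a) ∧
      Λ = ∑ a, tensor (Φ a) (Ψ a)

/-- LOCC channels: finite compositions of one-way rounds in either direction, through
arbitrary intermediate local systems. -/
inductive IsLOCC {A B : Type} [Fintype A] [Fintype B] :
    ∀ {A' B' : Type} [Fintype A'] [Fintype B'], SuperOp (A × B) (A' × B') → Prop
  | right {A' B' : Type} [Fintype A'] [Fintype B'] (Λ : SuperOp (A × B) (A' × B')) :
      IsOneWayRight Λ → IsLOCC Λ
  | left {A' B' : Type} [Fintype A'] [Fintype B'] (Λ : SuperOp (A × B) (A' × B')) :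
      IsOneWayLeft Λ → IsLOCC Λ
  | comp_right {A' B' A'' B'' : Type} [Fintype A'] [Fintype B'] [Fintype A''] [Fintype B'']
      (Γ : SuperOp (A' × B') (A'' × B'')) (Λ : SuperOp (A × B) (A' × B')) :
      IsLOCC Λ → IsOneWayRight Γ → IsLOCC (Γ ∘ₗ Λ)
  | comp_left {A' B' A'' B'' : Type} [Fintype A'] [Fintype B'] [Fintype A''] [Fintype B'']
      (Γ : SuperOp (A' × B') (A'' × B'')) (Λ : SuperOp (A × B) (A' × B')) :
      IsLOCC Λ → IsOneWayLeft Γ → IsLOCC (Γ ∘ₗ Λ)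

variable {A B : Type} [Fintype A] [Fintype B]

/-- Membership in the topological closure of the set of LOCC channels `AB → AB`; the topology
of pointwise convergence is the usual one on this finite-dimensional space of linear maps. -/
def IsClosureLOCC (F : SuperOp (A × B) (A × B)) : Prop :=
  (F : Op (A × B) → Op (A × B)) ∈
    closure {G | ∃ Λ : SuperOp (A × B) (A × B), IsLOCC Λ ∧ G = ⇑Λ}

/-- A measurement as a channel whose classical outcome is available to both parties,
`X ↦ ∑ x, tr (M x * X) |xx⟩⟨xx|`. -/
def outcomeChannel {r : ℕ} (M : Fin r → Op (A × B)) :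
    SuperOp (A × B) (Fin r × Fin r) where
  toFun X := ∑ x, (M x * X).trace • Matrix.single (x, x) (x, x) (1 : ℂ)
  map_add' X Y := by
    simp only [Matrix.mul_add, Matrix.trace_add, add_smul, Finset.sum_add_distrib]
  map_smul' c X := by
    simp only [Matrix.mul_smul, Matrix.trace_smul, smul_assoc, Finset.smul_sum,
      RingHom.id_apply]

variable [DecidableEq A] [DecidableEq B]

/-- LOCC measurements: POVMs that are implemented by an LOCC channel with classical output. -/
def IsLOCCMeas {r : ℕ} (M : Fin r → Op (A × B)) : Prop :=
  IsPOVM M ∧ IsLOCC (outcomeChannel M)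

/-- Membership in the topological closure of the set of LOCC measurements with `r` outcomes. -/
def IsClosureLOCCMeas {r : ℕ} (M : Fin r → Op (A × B)) : Prop :=
  M ∈ closure {N : Fin r → Op (A × B) | IsLOCCMeas N}

end LOCC

section Powers

/-- Measurement-cohering power: the minimum over detection-incoherent `F` of the maximum, over
incoherent measurements `M` of the system and an arbitrary ancilla of dimension `k ≥ 1`, of
`D_m(M ∘ (E ⊗ id)‖M ∘ (F ⊗ id))`. -/
def coheringPower {A : Type} [Fintype A] [DecidableEq A] (E : SuperOp A A) : EReal :=
  ⨅ (F : SuperOp A A) (_ : IsDIO F),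
    ⨆ (k : ℕ) (_ : 1 ≤ k) (r : ℕ) (M : Fin r → Op (A × Fin k)) (_ : IsIncoherentMeas M),
      measRelEntropy (preprocess M (ampRight E (Fin k))) (preprocess M (ampRight F (Fin k)))

/-- Measurement-entangling power: the minimum over `F` in the closure of LOCC channels of the
maximum, over `M` in the closure of LOCC measurements of `AS : BT` with ancillas `S`, `T` of
arbitrary dimensions `s, t ≥ 1`, of `D_m(M ∘ (E ⊗ id)‖M ∘ (F ⊗ id))`. -/
def entanglingPower {A B : Type} [Fintype A] [Fintype B] [DecidableEq A] [DecidableEq B]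
    (E : SuperOp (A × B) (A × B)) : EReal :=
  ⨅ (F : SuperOp (A × B) (A × B)) (_ : IsClosureLOCC F),
    ⨆ (s : ℕ) (_ : 1 ≤ s) (t : ℕ) (_ : 1 ≤ t) (r : ℕ)
      (M : Fin r → Op ((A × Fin s) × (B × Fin t))) (_ : IsClosureLOCCMeas M),
      measRelEntropy (preprocess M (ampBipartite E (Fin s) (Fin t)))
        (preprocess M (ampBipartite F (Fin s) (Fin t)))

/-- The generalized CNOT `∑ |i, i ⊕ j⟩⟨i j|`; addition in `Fin d` is modulo `d`. -/
def cnot (d : ℕ) [NeZero d] : Op (Fin d × Fin d) :=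
  ∑ i : Fin d, ∑ j : Fin d, Matrix.single (i, i + j) (i, j) 1

/-- The adjoint `X ↦ U† X U` of the generalized CNOT channel. -/
def cnotAdjoint (d : ℕ) [NeZero d] : SuperOp (Fin d × Fin d) (Fin d × Fin d) :=
  conjBy (cnot d)ᴴ

end Powers

end MeasRes

end

open MeasRes

/-! Write `E†` for the Heisenberg adjoint. The proof rests on data processing for POVM elements and
on the reduction criterion for separable maps.

A POVM element that is block-diagonal in the incoherent basis of `A` is `∑ i, |i⟩⟨i| ⊗ G i`, and `(E
⊗ id)†` sends it to `∑ i, E†(|i⟩⟨i|) ⊗ G i`. Data processing with weights `tr (G i)`, summed over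
outcomes, shows that such measurements never beat the basis measurement, even after a
trace-preserving CP map (`measRelEntropy_le_basisRelEntropy`). Hence the inner maximum in
`coheringPower` is `basisRelEntropy E F`.

Upper bound (`entanglingPower_le_coheringPower`): for `F` in DIO use `Δ ∘ K ∘ (F ⊗ id) ∘ L` as the
competitor. Since `K ∘ (F ⊗ id) ∘ L` is DIO, the competitor measures and prepares in the product
basis, so it is LOCC. In the Heisenberg picture `(Δ ∘ K)†` makes every POVM element block-diagonal,
because `Δ ∘ K = Δ ∘ K ∘ Δ`, and `L†` preserves traces because `L` is unital. The previous paragraph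
then applies to any POVM, LOCC or not.

Lower bound (`coheringPower_le_entanglingPower`): the adjoint of `Δ ∘ E ∘ U†` sends `|ij⟩⟨ij|` to a
copy of `E†(|i⟩⟨i|)` on the span of the `|a, a + j⟩`. If `F` is a limit of LOCC channels, `Y =
F†(|ij⟩⟨ij|)` satisfies `Y ≤ tr_B Y ⊗ 1`. On that span the right side is diagonal, and its average
over `j` is the adjoint image of `|i⟩⟨i|` under a classical channel `F'`. Joint convexity and
antitonicity of `D` in its second argument bound `basisRelEntropy E F'` by the value of the product
basis measurement, which is LOCC.

Data processing comes from `D(X‖Y) - tr X + tr Y = ∫₀¹ (1 - s) q(s) ds`, where `q(s)` is a quadratic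
form equal to a maximum over `Z` of expressions linear in `(X, Y)`; Kadison–Schwarz makes it
monotone. -/

noncomputable section

set_option linter.unusedSectionVars false

namespace MeasRes

/-! ### Eigenbases of two Hermitian matrices and their overlaps -/

section Spectral

variable {m : Type} [Fintype m] [DecidableEq m]

/-- The unitary matrix of eigenvectors of a Hermitian matrix. -/
def eigU {X : Op m} (hX : X.IsHermitian) : Op m := (hX.eigenvectorUnitary : Matrix m m ℂ)

theorem eigU_conj_mul {X : Op m} (hX : X.IsHermitian) : (eigU hX)ᴴ * eigU hX = 1 := by
  simp [eigU, ← Matrix.star_eq_conjTranspose]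

theorem eigU_mul_conj {X : Op m} (hX : X.IsHermitian) : eigU hX * (eigU hX)ᴴ = 1 := by
  simp [eigU, ← Matrix.star_eq_conjTranspose]

theorem eq_eigU_diagonal {X : Op m} (hX : X.IsHermitian) :
    X = eigU hX * Matrix.diagonal (fun i => (hX.eigenvalues i : ℂ)) * (eigU hX)ᴴ := by
  conv_lhs => rw [hX.spectral_theorem, Unitary.conjStarAlgAut_apply]
  rfl

theorem cfc_eq_eigU_diagonal {X : Op m} (hX : X.IsHermitian) (f : ℝ → ℝ) :
    cfc f X = eigU hX * Matrix.diagonal (fun i => ((f (hX.eigenvalues i) : ℝ) : ℂ)) *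
      (eigU hX)ᴴ := by
  rw [hX.cfc_eq, Matrix.IsHermitian.cfc, Unitary.conjStarAlgAut_apply]
  rfl

/-- The matrix of overlaps between the eigenvectors of two Hermitian matrices. -/
def overlap {X Y : Op m} (hX : X.IsHermitian) (hY : Y.IsHermitian) : Op m :=
  (eigU hX)ᴴ * eigU hY

theorem overlap_mul_conj {X Y : Op m} (hX : X.IsHermitian) (hY : Y.IsHermitian) :
    overlap hX hY * (overlap hX hY)ᴴ = 1 := by
  rw [overlap, Matrix.conjTranspose_mul, Matrix.conjTranspose_conjTranspose, Matrix.mul_assoc,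
    ← Matrix.mul_assoc (eigU hY), eigU_mul_conj, Matrix.one_mul, eigU_conj_mul]

theorem overlap_conj_mul {X Y : Op m} (hX : X.IsHermitian) (hY : Y.IsHermitian) :
    (overlap hX hY)ᴴ * overlap hX hY = 1 := by
  rw [overlap, Matrix.conjTranspose_mul, Matrix.conjTranspose_conjTranspose, Matrix.mul_assoc,
    ← Matrix.mul_assoc (eigU hX), eigU_mul_conj, Matrix.one_mul, eigU_conj_mul]

theorem sum_normSq_overlap_right {X Y : Op m} (hX : X.IsHermitian) (hY : Y.IsHermitian) (i : m) :
    ∑ j, Complex.normSq (overlap hX hY i j) = 1 := by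
  have h := congrFun (congrFun (overlap_mul_conj hX hY) i) i
  rw [Matrix.mul_apply] at h
  simp only [Matrix.conjTranspose_apply, Matrix.one_apply_eq, Complex.star_def,
    Complex.mul_conj] at h
  exact_mod_cast h

theorem sum_normSq_overlap_left {X Y : Op m} (hX : X.IsHermitian) (hY : Y.IsHermitian) (j : m) :
    ∑ i, Complex.normSq (overlap hX hY i j) = 1 := by
  have h := congrFun (congrFun (overlap_conj_mul hX hY) j) j
  rw [Matrix.mul_apply] at h
  simp only [Matrix.conjTranspose_apply, Matrix.one_apply_eq, Complex.star_def,
    mul_comm ((starRingEnd ℂ) _), Complex.mul_conj] at h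
  exact_mod_cast h

theorem trace_spectral_mul {X Y : Op m} (hX : X.IsHermitian) (hY : Y.IsHermitian) (f g : m → ℝ) :
    ((eigU hX * Matrix.diagonal (fun i => (f i : ℂ)) * (eigU hX)ᴴ) *
      (eigU hY * Matrix.diagonal (fun i => (g i : ℂ)) * (eigU hY)ᴴ)).trace.re =
      ∑ i, ∑ j, Complex.normSq (overlap hX hY i j) * (f i * g j) := by
  have h : ((eigU hX * Matrix.diagonal (fun i => (f i : ℂ)) * (eigU hX)ᴴ) *
      (eigU hY * Matrix.diagonal (fun i => (g i : ℂ)) * (eigU hY)ᴴ)).trace =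
      (Matrix.diagonal (fun i => (f i : ℂ)) * overlap hX hY *
        (Matrix.diagonal (fun i => (g i : ℂ)) * (overlap hX hY)ᴴ)).trace := by
    rw [Matrix.trace_mul_comm (Matrix.diagonal _ * overlap hX hY), Matrix.trace_mul_comm]
    simp only [overlap, Matrix.conjTranspose_mul, Matrix.conjTranspose_conjTranspose,
      Matrix.mul_assoc]
    rw [Matrix.trace_mul_comm (eigU hY)]
    simp only [Matrix.mul_assoc]
  rw [h, Matrix.trace, Complex.re_sum]
  refine Finset.sum_congr rfl fun i _ => ?_
  rw [Matrix.diag_apply, Matrix.mul_apply, Complex.re_sum]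
  refine Finset.sum_congr rfl fun j _ => ?_
  rw [Matrix.diagonal_mul, Matrix.diagonal_mul, Matrix.conjTranspose_apply, Complex.star_def]
  rw [show (f i : ℂ) * overlap hX hY i j * ((g j : ℂ) * (starRingEnd ℂ) (overlap hX hY i j)) =
    ((Complex.normSq (overlap hX hY i j) * (f i * g j) : ℝ) : ℂ) by
      push_cast [← Complex.mul_conj]; ring, Complex.ofReal_re]

theorem trace_re_eq_sum_overlap_left {X Y : Op m} (hX : X.IsHermitian) (hY : Y.IsHermitian) :
    X.trace.re = ∑ i, ∑ j, Complex.normSq (overlap hX hY i j) * hX.eigenvalues i := by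
  rw [hX.trace_eq_sum_eigenvalues, Complex.re_sum]
  refine Finset.sum_congr rfl fun i _ => ?_
  rw [← Finset.sum_mul, sum_normSq_overlap_right, one_mul]
  simp

theorem trace_re_eq_sum_overlap_right {X Y : Op m} (hX : X.IsHermitian) (hY : Y.IsHermitian) :
    Y.trace.re = ∑ i, ∑ j, Complex.normSq (overlap hX hY i j) * hY.eigenvalues j := by
  rw [hY.trace_eq_sum_eigenvalues, Complex.re_sum, Finset.sum_comm]
  refine Finset.sum_congr rfl fun j _ => ?_
  rw [← Finset.sum_mul, sum_normSq_overlap_left, one_mul]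
  simp

end Spectral

/-! ### Relative entropy as an integral of quadratic forms -/

section RelEnt

variable {m n : Type} [Fintype m] [DecidableEq m] [Fintype n] [DecidableEq n]

/-- The support of `X` is contained in the support of `Y`. -/
def SuppLE (X Y : Op m) : Prop := ∀ v : m → ℂ, Y *ᵥ v = 0 → X *ᵥ v = 0

/-- The real-valued relative entropy, meaningful when `SuppLE X Y`. -/
def relEnt (X Y : Op m) : ℝ :=
  (X * cfc Real.log X).trace.re - (X * cfc Real.log Y).trace.re

theorem relEntropy_of_suppLE {X Y : Op m} (h : SuppLE X Y) : relEntropy X Y = relEnt X Y :=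
  if_pos h

theorem relEntropy_of_not_suppLE {X Y : Op m} (h : ¬ SuppLE X Y) : relEntropy X Y = ⊤ :=
  if_neg h

theorem relEnt_zero_left (Y : Op m) : relEnt 0 Y = 0 := by simp [relEnt]

theorem suppLE_zero_left (Y : Op m) : SuppLE 0 Y := fun v _ => by simp

/-- The squared overlaps form a doubly stochastic matrix, so in the two eigenbases everything
reduces to scalar statements about pairs of eigenvalues. -/
theorem relEnt_eq_sum {X Y : Op m} (hX : X.IsHermitian) (hY : Y.IsHermitian) :
    relEnt X Y = ∑ i, ∑ j, Complex.normSq (overlap hX hY i j) *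
      (hX.eigenvalues i * (Real.log (hX.eigenvalues i) - Real.log (hY.eigenvalues j))) := by
  have h1 : (X * cfc Real.log X).trace.re =
      ∑ i, ∑ j, Complex.normSq (overlap hX hY i j) *
        (hX.eigenvalues i * Real.log (hX.eigenvalues i)) := by
    have h0 : X * cfc Real.log X = eigU hX * Matrix.diagonal (fun i =>
        ((hX.eigenvalues i * Real.log (hX.eigenvalues i) : ℝ) : ℂ)) * (eigU hX)ᴴ := by
      rw [cfc_eq_eigU_diagonal hX]
      conv_lhs => lhs; rw [eq_eigU_diagonal hX]
      simp only [Matrix.mul_assoc]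
      rw [← Matrix.mul_assoc (eigU hX)ᴴ (eigU hX), eigU_conj_mul, Matrix.one_mul,
        ← Matrix.mul_assoc (Matrix.diagonal _) (Matrix.diagonal _), Matrix.diagonal_mul_diagonal]
      simp only [Complex.ofReal_mul]
    rw [h0, Matrix.trace_mul_comm, ← Matrix.mul_assoc, eigU_conj_mul, Matrix.one_mul,
      Matrix.trace_diagonal, Complex.re_sum]
    refine Finset.sum_congr rfl fun i _ => ?_
    rw [← Finset.sum_mul, sum_normSq_overlap_right, one_mul, Complex.ofReal_re]
  have h2 : (X * cfc Real.log Y).trace.re =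
      ∑ i, ∑ j, Complex.normSq (overlap hX hY i j) *
        (hX.eigenvalues i * Real.log (hY.eigenvalues j)) := by
    rw [cfc_eq_eigU_diagonal hY]
    conv_lhs => rw [eq_eigU_diagonal hX]
    exact trace_spectral_mul hX hY _ _
  rw [relEnt, h1, h2, ← Finset.sum_sub_distrib]
  refine Finset.sum_congr rfl fun i _ => ?_
  rw [← Finset.sum_sub_distrib]
  exact Finset.sum_congr rfl fun j _ => by ring

/-- An interpolation whose increment over `[0, 1]` is `D(X‖Y) - tr X + tr Y`. -/
def interp {X Y : Op m} (hX : X.IsHermitian) (hY : Y.IsHermitian) (s : ℝ) : ℝ :=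
  ∑ i, ∑ j, Complex.normSq (overlap hX hY i j) *
    (hX.eigenvalues i * Real.log ((1 - s) * hY.eigenvalues j + s * hX.eigenvalues i) +
      (1 - s) * (hX.eigenvalues i - hY.eigenvalues j))

/-- The quadratic form `⟨X - Y, (s L_X + (1 - s) R_Y)⁻¹ (X - Y)⟩`. -/
def quad {X Y : Op m} (hX : X.IsHermitian) (hY : Y.IsHermitian) (s : ℝ) : ℝ :=
  ∑ i, ∑ j, Complex.normSq (overlap hX hY i j) *
    ((hX.eigenvalues i - hY.eigenvalues j) ^ 2 /
      ((1 - s) * hY.eigenvalues j + s * hX.eigenvalues i))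

theorem interp_one_sub_interp_zero {X Y : Op m} (hX : X.IsHermitian) (hY : Y.IsHermitian) :
    interp hX hY 1 - interp hX hY 0 = relEnt X Y - X.trace.re + Y.trace.re := by
  rw [relEnt_eq_sum hX hY, trace_re_eq_sum_overlap_left hX hY,
    trace_re_eq_sum_overlap_right hX hY, interp, interp]
  simp only [← Finset.sum_sub_distrib, ← Finset.sum_add_distrib]
  refine Finset.sum_congr rfl fun i _ => Finset.sum_congr rfl fun j _ => ?_
  simp only [sub_self, zero_mul, one_mul, zero_add, sub_zero, add_zero]
  ring

/-- With `u = (1 - s) q + s p` each term has derivative `p (p - q) / u - (p - q)`, and `p - u = (1 -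
s) (p - q)`. The case `p = 0` is separate because `u` may then vanish. -/
theorem hasDerivAt_interp {X Y : Op m} (hX : X.PosSemidef) (hY : Y.PosSemidef) {s : ℝ}
    (h0 : 0 < s) (h1 : s < 1) :
    HasDerivAt (interp hX.1 hY.1) ((1 - s) * quad hX.1 hY.1 s) s := by
  have h : (1 - s) * quad hX.1 hY.1 s = ∑ i, ∑ j, Complex.normSq (overlap hX.1 hY.1 i j) *
      ((1 - s) * ((hX.1.eigenvalues i - hY.1.eigenvalues j) ^ 2 /
      ((1 - s) * hY.1.eigenvalues j + s * hX.1.eigenvalues i))) := by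
    simp only [quad, Finset.mul_sum]
    exact Finset.sum_congr rfl fun i _ => Finset.sum_congr rfl fun j _ => by ring
  rw [h]
  refine HasDerivAt.fun_sum fun i _ => HasDerivAt.fun_sum fun j _ => HasDerivAt.const_mul _ ?_
  have hp := hX.eigenvalues_nonneg i
  have hq := hY.eigenvalues_nonneg j
  generalize hX.1.eigenvalues i = p at *
  generalize hY.1.eigenvalues j = q at *
  have hlin : HasDerivAt (fun s : ℝ => (1 - s) * q + s * p) (p - q) s := by
    have : HasDerivAt (fun s : ℝ => (1 - s) * q + s * p) (-1 * q + 1 * p) s :=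
      (((hasDerivAt_id s).const_sub 1).mul_const q).add ((hasDerivAt_id s).mul_const p)
    exact this.congr_deriv (by ring)
  have hlin2 : HasDerivAt (fun s : ℝ => (1 - s) * (p - q)) (-1 * (p - q)) s :=
    ((hasDerivAt_id s).const_sub 1).mul_const (p - q)
  rcases hp.eq_or_lt with rfl | hp
  · simp only [zero_mul, zero_add]
    refine hlin2.congr_deriv ?_
    rcases hq.eq_or_lt with rfl | hq
    · simp
    · have : (1 - s) ≠ 0 := by linarith
      field_simp
      ring
  · have hu : 0 < (1 - s) * q + s * p := by
      have := mul_pos h0 hp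
      have := mul_nonneg (sub_nonneg.2 h1.le) hq
      linarith
    refine ((hlin.log hu.ne').const_mul p).add hlin2 |>.congr_deriv ?_
    rw [mul_div_assoc', mul_div_assoc', div_add' _ _ _ hu.ne', div_left_inj' hu.ne']
    ring

/-- A null eigenvector of `Y` is killed by `X`, hence orthogonal to every eigenvector of `X` with
nonzero eigenvalue. This removes the terms `p log 0` with `p > 0`, the only obstruction to
continuity of `interp` at `s = 0`. -/
theorem mul_overlap_eq_zero {X Y : Op m} (hX : X.IsHermitian) (hY : Y.IsHermitian)
    (h : SuppLE X Y) {j : m} (hj : hY.eigenvalues j = 0) (i : m) :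
    (hX.eigenvalues i : ℂ) * overlap hX hY i j = 0 := by
  have hYv : Y *ᵥ (fun k => eigU hY k j) = 0 := by
    have h1 : Y * eigU hY = eigU hY * Matrix.diagonal (fun i => (hY.eigenvalues i : ℂ)) := by
      conv_lhs => lhs; rw [eq_eigU_diagonal hY]
      rw [Matrix.mul_assoc, eigU_conj_mul, Matrix.mul_one]
    funext k
    have h2 := congrFun (congrFun h1 k) j
    rw [Matrix.mul_diagonal, hj, Complex.ofReal_zero, mul_zero] at h2
    exact h2
  have hXv := h _ hYv
  have h3 : (eigU hX)ᴴ * X = Matrix.diagonal (fun i => (hX.eigenvalues i : ℂ)) * (eigU hX)ᴴ := by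
    conv_lhs => rhs; rw [eq_eigU_diagonal hX]
    rw [← Matrix.mul_assoc, ← Matrix.mul_assoc, eigU_conj_mul, Matrix.one_mul]
  have h4 : (eigU hX)ᴴ *ᵥ (X *ᵥ (fun k => eigU hY k j)) = 0 := by rw [hXv, Matrix.mulVec_zero]
  rw [Matrix.mulVec_mulVec, h3, ← Matrix.mulVec_mulVec] at h4
  have h5 := congrFun h4 i
  rw [Matrix.mulVec_diagonal] at h5
  exact h5

theorem continuousOn_interp {X Y : Op m} (hX : X.PosSemidef) (hY : Y.PosSemidef)
    (h : SuppLE X Y) : ContinuousOn (interp hX.1 hY.1) (Set.Icc 0 1) := by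
  refine continuousOn_finsetSum _ fun i _ => continuousOn_finsetSum _ fun j _ => ?_
  have hp := hX.eigenvalues_nonneg i
  have hq := hY.eigenvalues_nonneg j
  have hz := fun hj => mul_overlap_eq_zero hX.1 hY.1 h (j := j) hj i
  generalize hX.1.eigenvalues i = p at *
  generalize hY.1.eigenvalues j = q at *
  rcases hp.eq_or_lt with rfl | hp
  · simp only [zero_mul, zero_add]
    fun_prop
  rcases hq.eq_or_lt with rfl | hq
  · have h0 : overlap hX.1 hY.1 i j = 0 := by
      rcases mul_eq_zero.1 (hz rfl) with h | h
      · exact absurd (Complex.ofReal_eq_zero.1 h) hp.ne'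
      · exact h
    simp only [h0, map_zero, zero_mul]
    fun_prop
  · refine continuousOn_const.mul ((continuousOn_const.mul (ContinuousOn.log (by fun_prop) ?_)).add
      (by fun_prop))
    intro s hs
    have h1 := mul_nonneg (sub_nonneg.2 hs.2) hq.le
    have h2 := mul_nonneg hs.1 hp.le
    rcases hs.1.eq_or_lt with rfl | h0
    · simpa using hq.ne'
    · have := mul_pos h0 hp
      linarith

/-- The concave functional of `Z` whose maximum is `quad`. -/
def variational (s : ℝ) (Z X Y : Op m) : ℝ :=
  2 * (Zᴴ * (X - Y)).trace.re - s * (Zᴴ * X * Z).trace.re - (1 - s) * (Z * Y * Zᴴ).trace.re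

theorem variational_spectral {X Y : Op m} (hX : X.IsHermitian) (hY : Y.IsHermitian) (s : ℝ)
    (ζ : Op m) :
    variational s (eigU hX * ζ * (eigU hY)ᴴ) X Y = ∑ i, ∑ j,
      (2 * ((hX.eigenvalues i - hY.eigenvalues j) * (star (ζ i j) * overlap hX hY i j).re) -
        ((1 - s) * hY.eigenvalues j + s * hX.eigenvalues i) * Complex.normSq (ζ i j)) := by
  set P : Op m := Matrix.diagonal (fun i => (hX.eigenvalues i : ℂ)) with hP
  set Q : Op m := Matrix.diagonal (fun i => (hY.eigenvalues i : ℂ)) with hQ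
  have hU := eigU_conj_mul hX
  have hV := eigU_conj_mul hY
  have eX : X = eigU hX * P * (eigU hX)ᴴ := eq_eigU_diagonal hX
  have eY : Y = eigU hY * Q * (eigU hY)ᴴ := eq_eigU_diagonal hY
  have cU : ∀ M : Op m, (eigU hX)ᴴ * (eigU hX * M) = M := fun M => by
    rw [← Matrix.mul_assoc, hU, Matrix.one_mul]
  have cV : ∀ M : Op m, (eigU hY)ᴴ * (eigU hY * M) = M := fun M => by
    rw [← Matrix.mul_assoc, hV, Matrix.one_mul]
  have t1 : ((eigU hX * ζ * (eigU hY)ᴴ)ᴴ * X).trace = (ζᴴ * (P * overlap hX hY)).trace := by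
    refine (congrArg (fun T => ((eigU hX * ζ * (eigU hY)ᴴ)ᴴ * T).trace) eX).trans ?_
    simp only [Matrix.conjTranspose_mul, Matrix.conjTranspose_conjTranspose, Matrix.mul_assoc,
      cU, overlap]
    rw [Matrix.trace_mul_comm]
    simp only [Matrix.mul_assoc]
  have t2 : ((eigU hX * ζ * (eigU hY)ᴴ)ᴴ * Y).trace = (ζᴴ * (overlap hX hY * Q)).trace := by
    refine (congrArg (fun T => ((eigU hX * ζ * (eigU hY)ᴴ)ᴴ * T).trace) eY).trans ?_
    simp only [Matrix.conjTranspose_mul, Matrix.conjTranspose_conjTranspose, Matrix.mul_assoc,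
      overlap]
    rw [Matrix.trace_mul_comm]
    simp only [Matrix.mul_assoc, hV, Matrix.mul_one]
  have t3 : ((eigU hX * ζ * (eigU hY)ᴴ)ᴴ * X * (eigU hX * ζ * (eigU hY)ᴴ)).trace =
      (ζᴴ * (P * ζ)).trace := by
    refine (congrArg (fun T => ((eigU hX * ζ * (eigU hY)ᴴ)ᴴ * T *
      (eigU hX * ζ * (eigU hY)ᴴ)).trace) eX).trans ?_
    simp only [Matrix.conjTranspose_mul, Matrix.conjTranspose_conjTranspose, Matrix.mul_assoc,
      cU]
    rw [Matrix.trace_mul_comm]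
    simp only [Matrix.mul_assoc, hV, Matrix.mul_one]
  have t4 : ((eigU hX * ζ * (eigU hY)ᴴ) * Y * (eigU hX * ζ * (eigU hY)ᴴ)ᴴ).trace =
      (ζ * (Q * ζᴴ)).trace := by
    refine (congrArg (fun T => ((eigU hX * ζ * (eigU hY)ᴴ) * T *
      (eigU hX * ζ * (eigU hY)ᴴ)ᴴ).trace) eY).trans ?_
    simp only [Matrix.conjTranspose_mul, Matrix.conjTranspose_conjTranspose, Matrix.mul_assoc,
      cV]
    rw [Matrix.trace_mul_comm]
    simp only [Matrix.mul_assoc, hU, Matrix.mul_one]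
  have r1 : (ζᴴ * (P * overlap hX hY)).trace.re =
      ∑ i, ∑ j, hX.eigenvalues i * (star (ζ i j) * overlap hX hY i j).re := by
    rw [Matrix.trace, Complex.re_sum, Finset.sum_comm]
    refine Finset.sum_congr rfl fun j _ => ?_
    rw [Matrix.diag_apply, Matrix.mul_apply, Complex.re_sum]
    refine Finset.sum_congr rfl fun i _ => ?_
    rw [hP, Matrix.diagonal_mul, Matrix.conjTranspose_apply, ← Complex.re_ofReal_mul]
    congr 1; ring
  have r2 : (ζᴴ * (overlap hX hY * Q)).trace.re =
      ∑ i, ∑ j, hY.eigenvalues j * (star (ζ i j) * overlap hX hY i j).re := by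
    rw [Matrix.trace, Complex.re_sum, Finset.sum_comm]
    refine Finset.sum_congr rfl fun j _ => ?_
    rw [Matrix.diag_apply, Matrix.mul_apply, Complex.re_sum]
    refine Finset.sum_congr rfl fun i _ => ?_
    rw [hQ, Matrix.mul_diagonal, Matrix.conjTranspose_apply, ← Complex.re_ofReal_mul]
    congr 1; ring
  have r3 : (ζᴴ * (P * ζ)).trace.re =
      ∑ i, ∑ j, hX.eigenvalues i * Complex.normSq (ζ i j) := by
    rw [Matrix.trace, Complex.re_sum, Finset.sum_comm]
    refine Finset.sum_congr rfl fun j _ => ?_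
    rw [Matrix.diag_apply, Matrix.mul_apply, Complex.re_sum]
    refine Finset.sum_congr rfl fun i _ => ?_
    rw [hP, Matrix.diagonal_mul, Matrix.conjTranspose_apply, Complex.star_def,
      ← Complex.ofReal_re (_ * _)]
    congr 1; push_cast [← Complex.mul_conj]; ring
  have r4 : (ζ * (Q * ζᴴ)).trace.re =
      ∑ i, ∑ j, hY.eigenvalues j * Complex.normSq (ζ i j) := by
    rw [Matrix.trace, Complex.re_sum]
    refine Finset.sum_congr rfl fun i _ => ?_
    rw [Matrix.diag_apply, Matrix.mul_apply, Complex.re_sum]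
    refine Finset.sum_congr rfl fun j _ => ?_
    rw [hQ, Matrix.diagonal_mul, Matrix.conjTranspose_apply, Complex.star_def,
      ← Complex.ofReal_re (_ * _)]
    congr 1; push_cast [← Complex.mul_conj]; ring
  rw [variational, Matrix.mul_sub, Matrix.trace_sub, Complex.sub_re, t1, t2, t3, t4, r1, r2, r3, r4,
    Finset.mul_sum, Finset.mul_sum, ← Finset.sum_sub_distrib, Finset.mul_sum,
    ← Finset.sum_sub_distrib, ← Finset.sum_sub_distrib]
  refine Finset.sum_congr rfl fun i _ => ?_
  rw [Finset.mul_sum, Finset.mul_sum, ← Finset.sum_sub_distrib, Finset.mul_sum,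
    ← Finset.sum_sub_distrib, ← Finset.sum_sub_distrib]
  exact Finset.sum_congr rfl fun j _ => by ring

/-- In the two eigenbases the functional decouples over matrix entries, and each entry is bounded by
completing a square. A vanishing denominator forces both eigenvalues to be zero. -/
theorem variational_le_quad {X Y : Op m} (hX : X.PosSemidef) (hY : Y.PosSemidef) {s : ℝ}
    (h0 : 0 < s) (h1 : s < 1) (Z : Op m) : variational s Z X Y ≤ quad hX.1 hY.1 s := by
  have hZ : Z = eigU hX.1 * ((eigU hX.1)ᴴ * Z * eigU hY.1) * (eigU hY.1)ᴴ := by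
    simp only [Matrix.mul_assoc]
    rw [eigU_mul_conj, Matrix.mul_one, ← Matrix.mul_assoc, eigU_mul_conj, Matrix.one_mul]
  rw [hZ, variational_spectral hX.1 hY.1, quad]
  refine Finset.sum_le_sum fun i _ => Finset.sum_le_sum fun j _ => ?_
  have hp := hX.eigenvalues_nonneg i
  have hq := hY.eigenvalues_nonneg j
  generalize hX.1.eigenvalues i = p at *
  generalize hY.1.eigenvalues j = q at *
  generalize ((eigU hX.1)ᴴ * Z * eigU hY.1) i j = z
  generalize overlap hX.1 hY.1 i j = w
  have hq' := mul_nonneg (sub_nonneg.2 h1.le) hq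
  have hp' := mul_nonneg h0.le hp
  rcases (add_nonneg hq' hp').eq_or_lt with hu | hu
  · have hp0 : p = 0 := by
      rcases mul_eq_zero.1 (show s * p = 0 by linarith) with h | h
      · linarith
      · exact h
    have hq0 : q = 0 := by
      rcases mul_eq_zero.1 (show (1 - s) * q = 0 by linarith) with h | h
      · linarith
      · exact h
    simp [hp0, hq0]
  · generalize (1 - s) * q + s * p = u at *
    rw [mul_div_assoc', le_div_iff₀ hu]
    simp only [Complex.normSq_apply, Complex.mul_re, Complex.star_def, Complex.conj_re,
      Complex.conj_im]
    nlinarith [sq_nonneg ((p - q) * w.re - u * z.re), sq_nonneg ((p - q) * w.im - u * z.im)]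

theorem exists_variational_eq_quad {X Y : Op m} (hX : X.IsHermitian) (hY : Y.IsHermitian) (s : ℝ) :
    ∃ Z : Op m, variational s Z X Y = quad hX hY s := by
  refine ⟨eigU hX * (Matrix.of fun i j =>
    (((hX.eigenvalues i - hY.eigenvalues j) /
      ((1 - s) * hY.eigenvalues j + s * hX.eigenvalues i) : ℝ) : ℂ) * overlap hX hY i j) *
      (eigU hY)ᴴ, ?_⟩
  rw [variational_spectral, quad]
  refine Finset.sum_congr rfl fun i _ => Finset.sum_congr rfl fun j _ => ?_
  rw [Matrix.of_apply]
  generalize hX.eigenvalues i = p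
  generalize hY.eigenvalues j = q
  generalize overlap hX hY i j = w
  generalize (1 - s) * q + s * p = u
  simp only [Complex.normSq_apply, Complex.mul_re, Complex.mul_im, Complex.star_def,
    Complex.conj_re, Complex.conj_im, Complex.ofReal_re, Complex.ofReal_im]
  -- Division by zero makes both the entry of the maximizer and the term of `quad` vanish.
  rcases eq_or_ne u 0 with rfl | hu
  · simp
  · field_simp
    ring

end RelEnt

/-! ### Kraus maps, Kadison–Schwarz, and monotonicity of the quadratic form -/

section Kraus

variable {m n : Type} [Fintype m] [DecidableEq m] [Fintype n] [DecidableEq n]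

open scoped MatrixOrder in
theorem exists_eq_conjTranspose_mul_self {X : Op m} (hX : X.PosSemidef) :
    ∃ B : Op m, X = Bᴴ * B :=
  CStarAlgebra.nonneg_iff_eq_star_mul_self.1 (Matrix.nonneg_iff_posSemidef.2 hX)

theorem trace_mul_re_nonneg {P X : Op m} (hP : P.PosSemidef) (hX : X.PosSemidef) :
    0 ≤ (P * X).trace.re := by
  obtain ⟨B, rfl⟩ := exists_eq_conjTranspose_mul_self hX
  rw [← Matrix.mul_assoc, Matrix.trace_mul_comm, ← Matrix.mul_assoc]
  exact (Complex.le_def.1 (hP.mul_mul_conjTranspose_same B).trace_nonneg).1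

/-- The completely positive map `X ↦ ∑ k, K k * X * (K k)ᴴ`. -/
def krausMap {κ : Type} [Fintype κ] (K : κ → Matrix n m ℂ) : SuperOp m n where
  toFun X := ∑ k, K k * X * (K k)ᴴ
  map_add' X Y := by simp only [Matrix.mul_add, Matrix.add_mul, Finset.sum_add_distrib]
  map_smul' c X := by simp [Finset.smul_sum]

variable {κ : Type} [Fintype κ] (K : κ → Matrix n m ℂ)

theorem krausMap_apply (X : Op m) : krausMap K X = ∑ k, K k * X * (K k)ᴴ := rfl

/-- The adjoint of the Kraus map of `K`. -/
def krausAdj : SuperOp n m := krausMap fun k => (K k)ᴴ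

theorem krausAdj_apply (Z : Op n) : krausAdj K Z = ∑ k, (K k)ᴴ * Z * K k := by
  simp [krausAdj, krausMap_apply]

theorem krausAdj_conjTranspose (Z : Op n) : (krausAdj K Z)ᴴ = krausAdj K Zᴴ := by
  simp [krausAdj_apply, Matrix.conjTranspose_sum, Matrix.mul_assoc]

theorem trace_krausAdj_mul (Z : Op n) (X : Op m) :
    (krausAdj K Z * X).trace = (Z * krausMap K X).trace := by
  rw [krausAdj_apply, krausMap_apply, Finset.sum_mul, Finset.mul_sum, Matrix.trace_sum,
    Matrix.trace_sum]
  refine Finset.sum_congr rfl fun k _ => ?_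
  rw [Matrix.mul_assoc, Matrix.mul_assoc, Matrix.trace_mul_comm]
  simp only [Matrix.mul_assoc]

theorem posSemidef_krausMap {X : Op m} (hX : X.PosSemidef) : (krausMap K X).PosSemidef :=
  Matrix.posSemidef_sum _ fun k _ => hX.mul_mul_conjTranspose_same (K k)

/-- The defect of a Kraus map from multiplying traces by `c`. -/
def krausDefect (c : ℝ) : Op m := (c : ℂ) • 1 - krausAdj K 1

theorem krausDefect_isHermitian (c : ℝ) : (krausDefect K c)ᴴ = krausDefect K c := by
  simp [krausDefect, krausAdj_conjTranspose]

theorem trace_krausDefect_mul (c : ℝ) (X : Op m) :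
    (krausDefect K c * X).trace = c * X.trace - (krausMap K X).trace := by
  rw [krausDefect, Matrix.sub_mul, Matrix.trace_sub, trace_krausAdj_mul]
  simp

/-- Adjoin to the output a one-dimensional flag that absorbs the defect, so that the extended map
multiplies traces by exactly `c`. The extended adjoint takes `Z ⊕ z` to `c A`, and the inequality is
Kadison–Schwarz for it, exhibited as an explicit sum of positive terms. -/
theorem kadison_schwarz {c : ℝ} (he : (krausDefect K c).PosSemidef) (z : ℝ) (Z : Op n)
    (A : Op m) (hA : krausAdj K Z = (c : ℂ) • A - (z : ℂ) • krausDefect K c) :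
    (krausAdj K (Z * Zᴴ) + ((z : ℂ) * z) • krausDefect K c - (c : ℂ) • (A * Aᴴ)).PosSemidef := by
  have hA' : krausAdj K Zᴴ = (c : ℂ) • Aᴴ - (z : ℂ) • krausDefect K c := by
    rw [← krausAdj_conjTranspose, hA]
    simp [krausDefect_isHermitian]
  have h1 : krausAdj K 1 = (c : ℂ) • 1 - krausDefect K c := by simp [krausDefect]
  have h2 : ∑ k, ((K k)ᴴ * Z - A * (K k)ᴴ) * ((K k)ᴴ * Z - A * (K k)ᴴ)ᴴ =
      krausAdj K (Z * Zᴴ) - krausAdj K Z * Aᴴ - A * krausAdj K Zᴴ + A * krausAdj K 1 * Aᴴ := by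
    simp only [krausAdj_apply, Finset.sum_mul, Finset.mul_sum, ← Finset.sum_sub_distrib,
      ← Finset.sum_add_distrib]
    refine Finset.sum_congr rfl fun k _ => ?_
    simp only [Matrix.conjTranspose_sub, Matrix.conjTranspose_mul,
      Matrix.conjTranspose_conjTranspose, Matrix.sub_mul, Matrix.mul_sub, Matrix.mul_assoc,
      Matrix.mul_one]
    abel
  have h3 : krausAdj K (Z * Zᴴ) + ((z : ℂ) * z) • krausDefect K c - (c : ℂ) • (A * Aᴴ) =
      ∑ k, ((K k)ᴴ * Z - A * (K k)ᴴ) * ((K k)ᴴ * Z - A * (K k)ᴴ)ᴴ +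
        ((z : ℂ) • 1 - A) * krausDefect K c * ((z : ℂ) • 1 - A)ᴴ := by
    rw [h2, hA, hA', h1]
    simp only [Matrix.conjTranspose_sub, Matrix.conjTranspose_smul, Matrix.conjTranspose_one,
      Complex.star_def, Complex.conj_ofReal, Matrix.sub_mul, Matrix.mul_sub, Matrix.smul_mul,
      Matrix.mul_smul, Matrix.mul_one, Matrix.one_mul]
    module
  rw [h3]
  exact (Matrix.posSemidef_sum _ fun k _ => Matrix.posSemidef_self_mul_conjTranspose _).add
    (he.mul_mul_conjTranspose_same _)

/-- The pulled-back operator `A` is a trial operator for `(X, Y)`, and the two Kadison–Schwarz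
inequalities compare the quadratic terms. The flag contributes the extra `tr (e Y) / (1 - s)`, which
later accounts for the trace that `Y` loses. -/
theorem variational_krausMap_le {X Y : Op m} (hX : X.PosSemidef) (hY : Y.PosSemidef) {c : ℝ}
    (hc : 0 ≤ c) (he : (krausDefect K c).PosSemidef)
    (htr : (krausDefect K c * X).trace = 0) {s : ℝ} (h0 : 0 < s) (h1 : s < 1) (Z : Op n) :
    variational s Z (krausMap K X) (krausMap K Y) + (krausDefect K c * Y).trace.re / (1 - s) ≤
      c * quad hX.1 hY.1 s := by
  rcases hc.eq_or_lt with rfl | hc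
  -- For `c = 0` both `K†(1)` and `-K†(1)` are positive, so all Kraus operators vanish; otherwise
  -- `c` can be inverted.
  · have hpos : (krausAdj K 1).PosSemidef := posSemidef_krausMap _ Matrix.PosSemidef.one
    have hd : krausDefect K 0 = -krausAdj K 1 := by simp [krausDefect]
    have hz : krausAdj K 1 = 0 := by
      refine hpos.trace_eq_zero_iff.1 (le_antisymm ?_ hpos.trace_nonneg)
      have := he.trace_nonneg
      rw [hd, Matrix.trace_neg] at this
      simpa using this
    have hK : ∀ k, K k = 0 := by
      intro k
      have hk : (krausAdj K 1).trace = ∑ k, ((K k)ᴴ * K k).trace := by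
        simp [krausAdj_apply, Matrix.trace_sum]
      rw [hz, Matrix.trace_zero] at hk
      have := (Finset.sum_eq_zero_iff_of_nonneg (fun k _ =>
        (Matrix.posSemidef_conjTranspose_mul_self (K k)).trace_nonneg)).1 hk.symm k
        (Finset.mem_univ _)
      exact Matrix.trace_conjTranspose_mul_self_eq_zero_iff.1 this
    have hΦ : ∀ W, krausMap K W = 0 := by simp [krausMap_apply, hK]
    simp [hd, hz, hΦ, variational]
  set e := krausDefect K c with hedef
  -- This maximizes the flag part `-2 z t - (1 - s) z² t` of the functional, where `t = tr (e Y) ≥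
  -- 0`; the maximum is `t / (1 - s)`.
  set z : ℝ := -1 / (1 - s) with hzdef
  have hs : 1 - s ≠ 0 := by linarith
  set A : Op m := (c : ℂ)⁻¹ • (krausAdj K Z + (z : ℂ) • e) with hAdef
  have hcc : (c : ℂ) ≠ 0 := by exact_mod_cast hc.ne'
  have hA : krausAdj K Z = (c : ℂ) • A - (z : ℂ) • e := by
    rw [hAdef, smul_smul, mul_inv_cancel₀ hcc, one_smul, add_sub_cancel_right]
  have hA' : krausAdj K Zᴴ = (c : ℂ) • Aᴴ - (z : ℂ) • e := by
    rw [← krausAdj_conjTranspose, hA]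
    simp [hedef, krausDefect_isHermitian]
  have k1 := trace_mul_re_nonneg (kadison_schwarz K he z Z A hA) hX
  have k2 := trace_mul_re_nonneg (kadison_schwarz K he z Zᴴ Aᴴ hA') hY
  rw [← hedef] at k1 k2
  simp only [Matrix.conjTranspose_conjTranspose, Matrix.sub_mul, Matrix.add_mul,
    Matrix.trace_sub, Matrix.trace_add, trace_krausAdj_mul, Matrix.smul_mul, Matrix.trace_smul,
    smul_eq_mul, htr, ← Complex.ofReal_mul, Complex.sub_re, Complex.add_re,
    Complex.re_ofReal_mul, mul_zero, add_zero] at k1 k2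
  have k3 : c * (Aᴴ * (X - Y)).trace.re =
      (Zᴴ * (krausMap K X - krausMap K Y)).trace.re - z * (e * Y).trace.re := by
    have : (c : ℂ) * (Aᴴ * (X - Y)).trace =
        (Zᴴ * (krausMap K X - krausMap K Y)).trace - z * (e * Y).trace := by
      rw [← smul_eq_mul, ← Matrix.trace_smul, ← Matrix.smul_mul,
        show (c : ℂ) • Aᴴ = krausAdj K Zᴴ + (z : ℂ) • e by rw [hA']; abel,
        Matrix.add_mul, Matrix.trace_add, trace_krausAdj_mul, map_sub, Matrix.smul_mul,
        Matrix.mul_sub e, smul_sub, Matrix.trace_sub, Matrix.trace_smul, htr]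
      simp [Matrix.trace_smul, sub_eq_add_neg]
    have := congrArg Complex.re this
    simpa only [Complex.sub_re, Complex.re_ofReal_mul] using this
  have k4 := mul_le_mul_of_nonneg_left (variational_le_quad hX hY h0 h1 A) hc.le
  have t1 : ∀ {p : Type} [Fintype p] [DecidableEq p] (A X : Op p),
      (Aᴴ * X * A).trace = (A * Aᴴ * X).trace := fun A X => by
    rw [Matrix.trace_mul_comm, Matrix.mul_assoc]
  have t2 : ∀ {p : Type} [Fintype p] [DecidableEq p] (A X : Op p),
      (A * X * Aᴴ).trace = (Aᴴ * A * X).trace := fun A X => by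
    rw [Matrix.trace_mul_comm, Matrix.mul_assoc]
  refine le_trans ?_ k4
  simp only [variational, t1, t2]
  have hz1 : (e * Y).trace.re / (1 - s) = - z * (e * Y).trace.re := by
    rw [hzdef]; ring
  have hz2 : (1 - s) * (z * z) = - z := by
    rw [hzdef]; field_simp
  have k1' := mul_le_mul_of_nonneg_left k1 h0.le
  have k2' := mul_le_mul_of_nonneg_left k2 (sub_nonneg.2 h1.le)
  rw [hz1]
  have k5 : (1 - s) * (z * z * (e * Y).trace.re) = - z * (e * Y).trace.re := by
    rw [← mul_assoc, hz2]
  nlinarith [k1', k2', k3, k5]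

end Kraus

/-! ### Data processing for families of Kraus maps -/

section DataProcessing

variable {m n : Type} [Fintype m] [DecidableEq m] [Fintype n] [DecidableEq n]
  {ι : Type} [Fintype ι] {κ : ι → Type} [∀ i, Fintype (κ i)]

/-- The kernel of a sum of positive operators is the intersection of their kernels, so `v` is sent
by each adjoint Kraus operator into the kernel of the corresponding `Y i`. -/
theorem suppLE_sum_krausMap (K : ∀ i, κ i → Matrix n m ℂ) {X Y : ι → Op m}
    (hY : ∀ i, (Y i).PosSemidef) (h : ∀ i, SuppLE (X i) (Y i)) :
    SuppLE (∑ i, krausMap (K i) (X i)) (∑ i, krausMap (K i) (Y i)) := by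
  intro v hv
  have h1 : ∑ i, ∑ k, star ((K i k)ᴴ *ᵥ v) ⬝ᵥ (Y i *ᵥ ((K i k)ᴴ *ᵥ v)) = 0 := by
    have : star v ⬝ᵥ ((∑ i, krausMap (K i) (Y i)) *ᵥ v) = 0 := by rw [hv, dotProduct_zero]
    rw [← this]
    simp only [krausMap_apply, Matrix.sum_mulVec, dotProduct_sum]
    refine Finset.sum_congr rfl fun i _ => Finset.sum_congr rfl fun k _ => ?_
    rw [Matrix.star_mulVec, Matrix.conjTranspose_conjTranspose, ← Matrix.dotProduct_mulVec,
      Matrix.mulVec_mulVec, Matrix.mulVec_mulVec, Matrix.mul_assoc]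
  have hnn : ∀ i, ∀ k, 0 ≤ star ((K i k)ᴴ *ᵥ v) ⬝ᵥ (Y i *ᵥ ((K i k)ᴴ *ᵥ v)) := fun i k =>
    (hY i).dotProduct_mulVec_nonneg _
  have h2 := (Finset.sum_eq_zero_iff_of_nonneg fun i _ =>
    Finset.sum_nonneg fun k _ => hnn i k).1 h1
  simp only [krausMap_apply, Matrix.sum_mulVec]
  refine Finset.sum_eq_zero fun i hi => Finset.sum_eq_zero fun k hk => ?_
  have h3 := (Finset.sum_eq_zero_iff_of_nonneg fun k _ => hnn i k).1 (h2 i hi) k hk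
  rw [(hY i).dotProduct_mulVec_zero_iff] at h3
  rw [Matrix.mul_assoc, ← Matrix.mulVec_mulVec, ← Matrix.mulVec_mulVec, h i _ h3,
    Matrix.mulVec_zero]

/-- The data processing inequality for a family of trace-nonincreasing Kraus maps, up to scaling
factors `c i`. -/
theorem relEnt_sum_krausMap_le (K : ∀ i, κ i → Matrix n m ℂ) {X Y : ι → Op m}
    (hX : ∀ i, (X i).PosSemidef) (hY : ∀ i, (Y i).PosSemidef) {c : ι → ℝ} (hc : ∀ i, 0 ≤ c i)
    (he : ∀ i, (krausDefect (K i) (c i)).PosSemidef)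
    (htr : ∀ i, (krausMap (K i) (X i)).trace = c i * (X i).trace)
    (h : ∀ i, SuppLE (X i) (Y i)) :
    relEnt (∑ i, krausMap (K i) (X i)) (∑ i, krausMap (K i) (Y i)) ≤
      ∑ i, c i * relEnt (X i) (Y i) := by
  have hX' : (∑ i, krausMap (K i) (X i)).PosSemidef :=
    Matrix.posSemidef_sum _ fun i _ => posSemidef_krausMap (K i) (hX i)
  have hY' : (∑ i, krausMap (K i) (Y i)).PosSemidef :=
    Matrix.posSemidef_sum _ fun i _ => posSemidef_krausMap (K i) (hY i)
  have hsupp := suppLE_sum_krausMap K hY h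
  have htr' : ∀ i, (krausDefect (K i) (c i) * X i).trace = 0 := fun i => by
    rw [trace_krausDefect_mul, htr, sub_self]
  set μ : ℝ := ∑ i, (krausDefect (K i) (c i) * Y i).trace.re with hμ
  -- The inequality `H 0 ≤ H 1` is the claim: the term `s * μ` cancels the trace lost by the `Y i`,
  -- while the traces of the `X i` balance by `htr`.
  set H : ℝ → ℝ := fun s => ∑ i, c i * interp (hX i).1 (hY i).1 s - interp hX'.1 hY'.1 s - s * μ
    with hH
  have hquad : ∀ s, 0 < s → s < 1 →
      quad hX'.1 hY'.1 s + μ / (1 - s) ≤ ∑ i, c i * quad (hX i).1 (hY i).1 s := by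
    intro s h0 h1
    -- One maximizer for the summed output serves all `i`: for fixed `Z` the functional is additive
    -- in the pair of operators.
    obtain ⟨Z, hZ⟩ := exists_variational_eq_quad hX'.1 hY'.1 s
    have hsum : variational s Z (∑ i, krausMap (K i) (X i)) (∑ i, krausMap (K i) (Y i)) =
        ∑ i, variational s Z (krausMap (K i) (X i)) (krausMap (K i) (Y i)) := by
      simp only [variational, ← Finset.sum_sub_distrib, Finset.mul_sum, Finset.sum_mul,
        Matrix.trace_sum, Complex.re_sum]
    rw [← hZ, hsum, hμ, Finset.sum_div, ← Finset.sum_add_distrib]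
    exact Finset.sum_le_sum fun i _ =>
      variational_krausMap_le (K i) (hX i) (hY i) (hc i) (he i) (htr' i) h0 h1 Z
  have hderiv : ∀ s, 0 < s → s < 1 → HasDerivAt H (∑ i, c i * ((1 - s) * quad (hX i).1 (hY i).1 s) -
      (1 - s) * quad hX'.1 hY'.1 s - 1 * μ) s := fun s h0 h1 =>
    ((HasDerivAt.fun_sum fun i _ => (hasDerivAt_interp (hX i) (hY i) h0 h1).const_mul (c i)).sub
      (hasDerivAt_interp hX' hY' h0 h1)).sub ((hasDerivAt_id s).mul_const μ)
  have hmono : MonotoneOn H (Set.Icc 0 1) := by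
    refine monotoneOn_of_deriv_nonneg (convex_Icc 0 1) ?_ ?_ ?_
    · exact ((continuousOn_finsetSum _ fun i _ => continuousOn_const.mul
        (continuousOn_interp (hX i) (hY i) (h i))).sub (continuousOn_interp hX' hY' hsupp)).sub
        (by fun_prop)
    · rw [interior_Icc]
      exact fun s hs => (hderiv s hs.1 hs.2).differentiableAt.differentiableWithinAt
    · rw [interior_Icc]
      intro s hs
      rw [(hderiv s hs.1 hs.2).deriv]
      have h1s : 0 < 1 - s := by linarith [hs.2]
      have h1 := mul_le_mul_of_nonneg_left (hquad s hs.1 hs.2) h1s.le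
      have h2 : ∑ i, c i * ((1 - s) * quad (hX i).1 (hY i).1 s) =
          (1 - s) * ∑ i, c i * quad (hX i).1 (hY i).1 s := by
        rw [Finset.mul_sum]
        exact Finset.sum_congr rfl fun i _ => by ring
      rw [mul_add, mul_div_cancel₀ _ h1s.ne'] at h1
      linarith
  have h01 := hmono (Set.left_mem_Icc.2 zero_le_one) (Set.right_mem_Icc.2 zero_le_one) zero_le_one
  have hi := interp_one_sub_interp_zero hX'.1 hY'.1
  have hi' : ∑ i, c i * interp (hX i).1 (hY i).1 1 - ∑ i, c i * interp (hX i).1 (hY i).1 0 =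
      ∑ i, c i * relEnt (X i) (Y i) - ∑ i, c i * (X i).trace.re + ∑ i, c i * (Y i).trace.re := by
    simp only [← Finset.sum_sub_distrib, ← Finset.sum_add_distrib]
    exact Finset.sum_congr rfl fun i _ => by
      rw [← mul_sub, interp_one_sub_interp_zero]; ring
  have hx : (∑ i, krausMap (K i) (X i)).trace.re = ∑ i, c i * (X i).trace.re := by
    simp [Matrix.trace_sum, htr]
  have hy : μ = ∑ i, c i * (Y i).trace.re - (∑ i, krausMap (K i) (Y i)).trace.re := by
    simp [hμ, Matrix.trace_sum, trace_krausDefect_mul]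
  simp only [hH] at h01
  linarith

end DataProcessing

/-! ### Adjoints, Kraus decompositions, and amplification -/

section Dual

variable {m n p : Type} [Fintype m] [DecidableEq m] [Fintype n] [DecidableEq n]
  [Fintype p] [DecidableEq p]

theorem dual_eq_of_trace {Φ : SuperOp m n} {Y : Op n} {W : Op m}
    (h : ∀ X, (W * X).trace = (Y * Φ X).trace) : dual Φ Y = W := by
  ext i j
  rw [dual, Matrix.of_apply, ← h, Matrix.trace_mul_single]
  simp

theorem dual_comp (Φ : SuperOp m n) (Ψ : SuperOp n p) (Y : Op p) :
    dual (Ψ ∘ₗ Φ) Y = dual Φ (dual Ψ Y) :=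
  dual_eq_of_trace fun X => by rw [trace_dual_mul, trace_dual_mul]; rfl

/-- The adjoint map as a linear map. -/
def dualHom (Φ : SuperOp m n) : SuperOp n m where
  toFun := dual Φ
  map_add' X Y := dual_eq_of_trace fun W => by
    rw [Matrix.add_mul, Matrix.trace_add, trace_dual_mul, trace_dual_mul, Matrix.add_mul,
      Matrix.trace_add]
  map_smul' c X := dual_eq_of_trace fun W => by
    simp [trace_dual_mul]

theorem dualHom_apply (Φ : SuperOp m n) (Y : Op n) : dualHom Φ Y = dual Φ Y := rfl

theorem dual_sum {ι : Type} (s : Finset ι) (Φ : SuperOp m n) (Y : ι → Op n) :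
    dual Φ (∑ i ∈ s, Y i) = ∑ i ∈ s, dual Φ (Y i) := map_sum (dualHom Φ) Y s

theorem dual_sum_left {ι : Type} (s : Finset ι) (Φ : ι → SuperOp m n) (Y : Op n) :
    dual (∑ i ∈ s, Φ i) Y = ∑ i ∈ s, dual (Φ i) Y :=
  dual_eq_of_trace fun X => by
    simp [Finset.sum_mul, Finset.mul_sum, Matrix.trace_sum, trace_dual_mul]

theorem dual_one {Φ : SuperOp m n} (h : IsTP Φ) : dual Φ 1 = 1 :=
  dual_eq_of_trace fun X => by simp [h X]

theorem trace_dual (Φ : SuperOp m n) (Y : Op n) : (dual Φ Y).trace = (Y * Φ 1).trace := by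
  rw [← trace_dual_mul, Matrix.mul_one]

/-- Data processing is applied to POVM elements, so pre-processing channels act through their
adjoints; unitality is what makes these preserve traces. -/
theorem isTP_dualHom {Φ : SuperOp m m} (h : IsUnital Φ) : IsTP (dualHom Φ) := fun Y => by
  rw [dualHom_apply, trace_dual, h, Matrix.mul_one]

theorem dual_single_apply (Φ : SuperOp m n) (x : n) (i j : m) :
    dual Φ (Matrix.single x x 1) i j = Φ (Matrix.single j i 1) x x := by
  rw [dual, Matrix.of_apply, Matrix.trace_mul_comm, Matrix.trace_mul_single]
  simp

theorem dual_krausMap {κ : Type} [Fintype κ] (K : κ → Matrix n m ℂ) (Y : Op n) :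
    dual (krausMap K) Y = krausAdj K Y :=
  dual_eq_of_trace fun X => trace_krausAdj_mul K Y X

/-- Maps that admit a Kraus decomposition. -/
def HasKraus {m n : Type} [Fintype m] [Fintype n] (Φ : SuperOp m n) : Prop :=
  ∃ (κ : Type) (_ : Fintype κ) (K : κ → Matrix n m ℂ), Φ = krausMap K

theorem hasKraus_krausMap {κ : Type} [Fintype κ] (K : κ → Matrix n m ℂ) :
    HasKraus (krausMap K) := ⟨κ, inferInstance, K, rfl⟩

theorem krausMap_comp {κ κ' : Type} [Fintype κ] [Fintype κ'] (K : κ → Matrix n m ℂ)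
    (L : κ' → Matrix p n ℂ) :
    krausMap L ∘ₗ krausMap K = krausMap fun x : κ' × κ => L x.1 * K x.2 := by
  ext1 X
  simp only [krausMap_apply, LinearMap.comp_apply, map_sum, Fintype.sum_prod_type,
    Matrix.conjTranspose_mul, Matrix.mul_assoc]
  exact Finset.sum_comm

theorem HasKraus.comp {Ψ : SuperOp n p} {Φ : SuperOp m n} (hΨ : HasKraus Ψ) (hΦ : HasKraus Φ) :
    HasKraus (Ψ ∘ₗ Φ) := by
  obtain ⟨κ', _, L, rfl⟩ := hΨ
  obtain ⟨κ, _, K, rfl⟩ := hΦ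
  rw [krausMap_comp]
  exact hasKraus_krausMap _

theorem HasKraus.posSemidef {Φ : SuperOp m n} (hΦ : HasKraus Φ) {X : Op m} (hX : X.PosSemidef) :
    (Φ X).PosSemidef := by
  obtain ⟨κ, _, K, rfl⟩ := hΦ
  exact posSemidef_krausMap K hX

theorem HasKraus.dualHom {Φ : SuperOp m n} (hΦ : HasKraus Φ) : HasKraus (dualHom Φ) := by
  obtain ⟨κ, _, K, rfl⟩ := hΦ
  exact ⟨κ, inferInstance, fun k => (K k)ᴴ, LinearMap.ext fun Y => dual_krausMap K Y⟩

theorem HasKraus.dual_posSemidef {Φ : SuperOp m n} (hΦ : HasKraus Φ) {Y : Op n}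
    (hY : Y.PosSemidef) : (dual Φ Y).PosSemidef := hΦ.dualHom.posSemidef hY

theorem HasKraus.smul {Φ : SuperOp m n} (hΦ : HasKraus Φ) {c : ℝ} (hc : 0 ≤ c) :
    HasKraus ((c : ℂ) • Φ) := by
  obtain ⟨κ, _, K, rfl⟩ := hΦ
  refine ⟨κ, inferInstance, fun k => ((Real.sqrt c : ℝ) : ℂ) • K k, LinearMap.ext fun X => ?_⟩
  rw [LinearMap.smul_apply, krausMap_apply, krausMap_apply, Finset.smul_sum]
  refine Finset.sum_congr rfl fun k _ => ?_
  rw [Matrix.conjTranspose_smul, Complex.star_def, Complex.conj_ofReal, Matrix.smul_mul,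
    Matrix.smul_mul, Matrix.mul_smul, smul_smul, ← Complex.ofReal_mul, Real.mul_self_sqrt hc]

theorem hasKraus_id : HasKraus (LinearMap.id : SuperOp m m) :=
  ⟨Unit, inferInstance, fun _ => 1, LinearMap.ext fun X => by simp [krausMap_apply]⟩

theorem hasKraus_conjBy (V : Op m) : HasKraus (conjBy V) :=
  ⟨Unit, inferInstance, fun _ => V, LinearMap.ext fun X => by simp [krausMap_apply, conjBy]⟩

/-- Restriction of an operator along a map of basis labels. -/
def pullback {m p : Type} (f : p → m) : SuperOp m p where
  toFun X := X.submatrix f f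
  map_add' _ _ := rfl
  map_smul' _ _ := rfl

theorem pullback_apply (f : p → m) (X : Op m) : pullback f X = X.submatrix f f := rfl

theorem pullback_eq_krausMap (f : p → m) :
    pullback f = krausMap fun _ : Unit => (1 : Op m).submatrix f id := by
  ext1 X
  ext i j
  simp [pullback_apply, krausMap_apply, Matrix.mul_apply, Matrix.one_apply]

theorem hasKraus_pullback (f : p → m) : HasKraus (pullback f) :=
  ⟨Unit, inferInstance, _, pullback_eq_krausMap f⟩

theorem isTP_pullback (e : p ≃ m) : IsTP (pullback e) := fun X =>
  Equiv.sum_comp e fun i => X i i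

theorem dual_pullback (e : p ≃ m) (Y : Op p) : dual (pullback e) Y = pullback e.symm Y :=
  dual_eq_of_trace fun X => by
    rw [← isTP_pullback e (pullback e.symm Y * X), pullback_apply, pullback_apply, pullback_apply,
      ← Matrix.submatrix_mul_equiv _ _ e e e]
    simp

theorem ampRight_krausMap {κ : Type} [Fintype κ] (K : κ → Matrix n m ℂ) :
    ampRight (krausMap K) p = krausMap fun k => K k ⊗ₖ (1 : Op p) := by
  ext1 X
  ext x y
  simp [ampRight, krausMap_apply, Matrix.sum_apply, Matrix.mul_apply, Fintype.sum_prod_type,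
    Matrix.one_apply, Finset.sum_mul, apply_ite (starRingEnd ℂ)]

theorem ampLeft_krausMap {κ : Type} [Fintype κ] (K : κ → Matrix n m ℂ) :
    ampLeft p (krausMap K) = krausMap fun k => (1 : Op p) ⊗ₖ K k := by
  ext1 X
  ext x y
  simp [ampLeft, krausMap_apply, Matrix.sum_apply, Matrix.mul_apply, Fintype.sum_prod_type,
    Matrix.one_apply, Finset.sum_mul, apply_ite (starRingEnd ℂ)]

theorem tensor_krausMap {m' n' κ κ' : Type} [Fintype m'] [Fintype n'] [DecidableEq m']
    [DecidableEq n'] [Fintype κ] [Fintype κ']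
    (K : κ → Matrix m' m ℂ) (L : κ' → Matrix n' n ℂ) :
    tensor (krausMap K) (krausMap L) = krausMap fun x : κ × κ' => K x.1 ⊗ₖ L x.2 := by
  rw [tensor, ampRight_krausMap, ampLeft_krausMap, krausMap_comp]
  congr 1
  funext x
  rw [← Matrix.mul_kronecker_mul, Matrix.mul_one, Matrix.one_mul]

theorem HasKraus.ampRight {Φ : SuperOp m n} (hΦ : HasKraus Φ) :
    HasKraus (MeasRes.ampRight Φ p) := by
  obtain ⟨κ, _, K, rfl⟩ := hΦ
  rw [ampRight_krausMap]
  exact hasKraus_krausMap _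

theorem HasKraus.isCP {Φ : SuperOp m n} (hΦ : HasKraus Φ) : IsCP Φ :=
  fun _ _ hX => hΦ.ampRight.posSemidef hX

/-- Choi's theorem. -/
theorem IsCP.hasKraus {Φ : SuperOp m n} (hΦ : IsCP Φ) : HasKraus Φ := by
  set e := Fintype.equivFin m
  -- The unnormalized maximally entangled vector, so that `hC` is positivity of the Choi matrix. The
  -- rows of a factor `B` with Choi matrix `Bᴴ * B` reshape into the Kraus operators.
  set v : m × Fin (Fintype.card m) → ℂ := fun x => if e x.1 = x.2 then 1 else 0 with hv
  have hC := hΦ (Fintype.card m) _ (Matrix.posSemidef_vecMulVec_self_star v)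
  obtain ⟨B, hB⟩ := exists_eq_conjTranspose_mul_self hC
  refine ⟨n × Fin (Fintype.card m), inferInstance,
    fun l => Matrix.of fun p i => star (B l (p, e i)), LinearMap.ext fun X => ?_⟩
  have hentry : ∀ i j p q, Φ (Matrix.single i j 1) p q =
      ∑ l, star (B l (p, e i)) * B l (q, e j) := by
    intro i j p q
    have h1 := congrFun (congrFun hB (p, e i)) (q, e j)
    rw [Matrix.mul_apply] at h1
    simp only [Matrix.conjTranspose_apply] at h1
    rw [← h1]
    change Φ _ p q = Φ _ p q
    refine congrFun (congrFun (congrArg Φ ?_) p) q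
    ext a b
    simp only [hv, Matrix.vecMulVec_apply, Matrix.single_apply, Matrix.of_apply, Pi.star_apply,
      EmbeddingLike.apply_eq_iff_eq]
    by_cases ha : i = a <;> by_cases hb : j = b <;> simp [ha, hb, eq_comm]
  conv_lhs => rw [Matrix.matrix_eq_sum_single X]
  have hs : ∀ i j : m, Matrix.single i j (X i j) = X i j • Matrix.single i j (1 : ℂ) := by
    intro i j
    simp [Matrix.smul_single]
  ext p q
  simp only [hs, map_sum, map_smul, Matrix.sum_apply, Matrix.smul_apply, hentry, krausMap_apply,
    Matrix.mul_apply, Matrix.of_apply, Matrix.conjTranspose_apply, star_star, smul_eq_mul,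
    Finset.mul_sum, Finset.sum_mul]
  rw [Finset.sum_comm]
  simp_rw [Finset.sum_comm (s := (Finset.univ : Finset m))
    (t := (Finset.univ : Finset (n × Fin (Fintype.card m))))]
  refine Finset.sum_congr rfl fun l _ => Finset.sum_congr rfl fun j _ =>
    Finset.sum_congr rfl fun i _ => ?_
  ring

theorem IsTP.comp {Ψ : SuperOp n p} {Φ : SuperOp m n} (hΨ : IsTP Ψ) (hΦ : IsTP Φ) :
    IsTP (Ψ ∘ₗ Φ) := fun X => (hΨ _).trans (hΦ X)

theorem trace_ampRight (Φ : SuperOp m n) (X : Op (m × p)) :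
    (MeasRes.ampRight Φ p X).trace =
      ∑ k, (Φ (Matrix.of fun i j => X (i, k) (j, k))).trace := by
  rw [Matrix.trace, Fintype.sum_prod_type, Finset.sum_comm]
  rfl

theorem IsTP.ampRight {Φ : SuperOp m n} (hΦ : IsTP Φ) : IsTP (MeasRes.ampRight Φ p) := by
  intro X
  rw [trace_ampRight, Matrix.trace, Fintype.sum_prod_type, Finset.sum_comm]
  refine Finset.sum_congr rfl fun k _ => ?_
  rw [hΦ]
  rfl

theorem IsUnital.ampRight {Φ : SuperOp m m} (hΦ : IsUnital Φ) :
    IsUnital (MeasRes.ampRight Φ p) := by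
  ext x y
  have h : (Matrix.of fun i j => (1 : Op (m × p)) (i, x.2) (j, y.2)) =
      if x.2 = y.2 then (1 : Op m) else 0 := by
    ext i j
    split_ifs with h <;> simp [Matrix.one_apply, h]
  change Φ (Matrix.of fun i j => (1 : Op (m × p)) (i, x.2) (j, y.2)) x.1 y.1 = _
  rw [h]
  split_ifs with h
  · rw [hΦ]
    simp [Matrix.one_apply, Prod.ext_iff, h]
  · simp [Prod.ext_iff, h]

end Dual

/-! ### Ancillas on both sides of a bipartite system -/

section Bipartite

variable {A B A' B' A'' B'' S T : Type} [Fintype A] [Fintype B] [Fintype A'] [Fintype B']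
  [Fintype S] [Fintype T] [DecidableEq A] [DecidableEq B] [DecidableEq A'] [DecidableEq B']
  [DecidableEq S] [DecidableEq T]

theorem ampBipartite_eq (Φ : SuperOp (A × B) (A' × B')) :
    ampBipartite Φ S T = pullback (Equiv.prodProdProdComm A' S B' T) ∘ₗ
      ampRight Φ (S × T) ∘ₗ pullback (Equiv.prodProdProdComm A S B T).symm := rfl

theorem ampBipartite_comp (Ψ : SuperOp (A' × B') (A'' × B'')) (Φ : SuperOp (A × B) (A' × B')) :
    ampBipartite (Ψ ∘ₗ Φ) S T = ampBipartite Ψ S T ∘ₗ ampBipartite Φ S T := rfl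

theorem HasKraus.ampBipartite {Φ : SuperOp (A × B) (A' × B')} (hΦ : HasKraus Φ) :
    HasKraus (MeasRes.ampBipartite Φ S T) := by
  rw [ampBipartite_eq]
  exact (hasKraus_pullback _).comp (hΦ.ampRight.comp (hasKraus_pullback _))

theorem IsTP.ampBipartite {Φ : SuperOp (A × B) (A' × B')} (hΦ : IsTP Φ) :
    IsTP (MeasRes.ampBipartite Φ S T) := by
  rw [ampBipartite_eq]
  exact (isTP_pullback _).comp (hΦ.ampRight.comp (isTP_pullback _))

theorem IsUnital.ampBipartite {Φ : SuperOp (A × B) (A × B)} (hΦ : IsUnital Φ) :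
    IsUnital (MeasRes.ampBipartite Φ S T) := by
  have h := IsUnital.ampRight (p := S × T) hΦ
  rw [IsUnital] at h
  simp [IsUnital, ampBipartite_eq, pullback_apply, h]

/-- The map `Φ ⊗ id_B ⊗ id_S ⊗ id_T` as a single amplification by `S × B × T`. -/
theorem ampBipartite_ampRight (Φ : SuperOp A A') :
    ampBipartite (ampRight Φ B) S T = pullback (Equiv.prodAssoc A' S (B × T)) ∘ₗ
      ampRight Φ (S × B × T) ∘ₗ pullback (Equiv.prodAssoc A S (B × T)).symm := rfl

end Bipartite

/-! ### Classical maps, dephasing, and detection-incoherent channels -/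

section Classical

variable {m n p : Type} [Fintype m] [DecidableEq m] [Fintype n] [DecidableEq n]
  [Fintype p] [DecidableEq p]

/-- The map that measures in the incoherent basis and prepares basis states according to the
transition weights `P`. -/
def classicalMap {m n : Type} [Fintype m] [DecidableEq n] (P : m → n → ℝ) : SuperOp m n where
  toFun X := Matrix.diagonal fun j => ∑ i, (P i j : ℂ) * X i i
  map_add' X Y := by
    rw [Matrix.diagonal_add]
    simp only [Matrix.add_apply, mul_add, Finset.sum_add_distrib]
  map_smul' c X := by
    rw [RingHom.id_apply, ← Matrix.diagonal_smul]
    congr 1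
    funext j
    simp only [Matrix.smul_apply, smul_eq_mul, Pi.smul_apply, Finset.mul_sum]
    exact Finset.sum_congr rfl fun i _ => by ring

theorem classicalMap_apply (P : m → n → ℝ) (X : Op m) :
    classicalMap P X = Matrix.diagonal fun j => ∑ i, (P i j : ℂ) * X i i := rfl

/-- Transition weights of a stochastic map. -/
def IsStochastic (P : m → n → ℝ) : Prop := (∀ i j, 0 ≤ P i j) ∧ ∀ i, ∑ j, P i j = 1

theorem hasKraus_classicalMap {P : m → n → ℝ} (h : ∀ i j, 0 ≤ P i j) :
    HasKraus (classicalMap P) := by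
  refine ⟨m × n, inferInstance, fun x =>
    Matrix.single x.2 x.1 ((Real.sqrt (P x.1 x.2) : ℝ) : ℂ), LinearMap.ext fun X => ?_⟩
  have hterm : ∀ x : m × n, Matrix.single x.2 x.1 ((Real.sqrt (P x.1 x.2) : ℝ) : ℂ) * X *
      (Matrix.single x.2 x.1 ((Real.sqrt (P x.1 x.2) : ℝ) : ℂ))ᴴ =
      Matrix.single x.2 x.2 ((P x.1 x.2 : ℂ) * X x.1 x.1) := by
    intro x
    rw [Matrix.conjTranspose_single, Matrix.single_mul_mul_single, Complex.star_def,
      Complex.conj_ofReal]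
    congr 1
    rw [mul_right_comm, ← Complex.ofReal_mul, Real.mul_self_sqrt (h _ _)]
  rw [krausMap_apply]
  simp only [hterm, classicalMap_apply, Fintype.sum_prod_type]
  ext a b
  simp only [Matrix.diagonal_apply, Matrix.sum_apply, Matrix.single_apply]
  split_ifs with hab
  · subst hab
    simp
  · refine (Finset.sum_eq_zero fun i _ => Finset.sum_eq_zero fun j _ => if_neg ?_).symm
    rintro ⟨rfl, rfl⟩
    exact hab rfl

theorem isTP_classicalMap {P : m → n → ℝ} (h : ∀ i, ∑ j, P i j = 1) :
    IsTP (classicalMap P) := by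
  intro X
  rw [classicalMap_apply, Matrix.trace_diagonal, Finset.sum_comm]
  refine Finset.sum_congr rfl fun i _ => ?_
  rw [← Finset.sum_mul, ← Complex.ofReal_sum, h, Complex.ofReal_one, one_mul, Matrix.diag_apply]

theorem IsStochastic.isChannel {P : m → n → ℝ} (h : IsStochastic P) :
    IsChannel (classicalMap P) :=
  ⟨(hasKraus_classicalMap h.1).isCP, isTP_classicalMap h.2⟩

theorem classicalMap_comp (P : m → n → ℝ) (Q : n → p → ℝ) :
    classicalMap Q ∘ₗ classicalMap P = classicalMap fun i k => ∑ j, P i j * Q j k := by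
  ext1 X
  simp only [LinearMap.comp_apply, classicalMap_apply, Matrix.diagonal_apply_eq]
  congr 1
  funext k
  push_cast
  simp only [Finset.mul_sum, Finset.sum_mul]
  rw [Finset.sum_comm]
  exact Finset.sum_congr rfl fun i _ => Finset.sum_congr rfl fun j _ => by ring

theorem sum_classicalMap {ι : Type} [Fintype ι] (P : ι → m → n → ℝ) :
    ∑ a, classicalMap (P a) = classicalMap fun i j => ∑ a, P a i j := by
  ext1 X
  ext j k
  simp only [LinearMap.sum_apply, classicalMap_apply, Matrix.sum_apply, Matrix.diagonal_apply]
  split_ifs with h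
  · push_cast
    simp only [Finset.sum_mul]
    exact Finset.sum_comm
  · simp

theorem tensor_classicalMap {m' n' : Type} [Fintype m'] [DecidableEq m'] [Fintype n']
    [DecidableEq n'] (P : m → m' → ℝ) (Q : n → n' → ℝ) :
    tensor (classicalMap P) (classicalMap Q) =
      classicalMap fun (x : m × n) (y : m' × n') => P x.1 y.1 * Q x.2 y.2 := by
  ext1 X
  ext y z
  simp only [tensor, ampRight, ampLeft, LinearMap.comp_apply, LinearMap.coe_mk, AddHom.coe_mk,
    Matrix.of_apply, classicalMap_apply, Matrix.diagonal_apply, Prod.ext_iff]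
  by_cases h1 : y.1 = z.1 <;> by_cases h2 : y.2 = z.2 <;>
    simp [h1, h2, Fintype.sum_prod_type, Finset.mul_sum, mul_assoc]

theorem dual_classicalMap_single (P : m → n → ℝ) (j : n) :
    dual (classicalMap P) (Matrix.single j j 1) = Matrix.diagonal fun i => (P i j : ℂ) := by
  ext a b
  rw [dual_single_apply, classicalMap_apply, Matrix.diagonal_apply_eq, Matrix.diagonal_apply]
  simp only [Matrix.single_apply]
  split_ifs with h
  · subst h
    simp
  · refine Finset.sum_eq_zero fun i _ => ?_
    rw [if_neg, mul_zero]
    rintro ⟨rfl, rfl⟩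
    exact h rfl

theorem dephase_apply (X : Op m) : dephase m X = Matrix.diagonal fun i => X i i := rfl

theorem dephase_eq_classicalMap :
    dephase m = classicalMap fun i j => if i = j then 1 else 0 := by
  ext1 X
  rw [dephase_apply, classicalMap_apply]
  refine congrArg Matrix.diagonal (funext fun j => ?_)
  rw [Finset.sum_eq_single j (fun i _ hi => by rw [if_neg hi, Complex.ofReal_zero, zero_mul])
    (by simp), if_pos rfl, Complex.ofReal_one, one_mul]

theorem isStochastic_ite (e : m → n) :
    IsStochastic fun i j => if e i = j then (1 : ℝ) else 0 :=
  ⟨fun i j => by positivity, fun i => by simp⟩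

theorem hasKraus_dephase : HasKraus (dephase m) := by
  rw [dephase_eq_classicalMap]
  exact hasKraus_classicalMap (isStochastic_ite id).1

theorem isTP_dephase : IsTP (dephase m) := fun X => by
  rw [dephase_apply, Matrix.trace_diagonal]
  rfl

/-- Transition weights of a channel in the incoherent basis. -/
def transition (Φ : SuperOp m n) (i : m) (j : n) : ℝ := (Φ (Matrix.single i i 1) j j).re

theorem posSemidef_single (i : m) : (Matrix.single i i (1 : ℂ)).PosSemidef := by
  rw [← Matrix.diagonal_single]
  exact Matrix.PosSemidef.diagonal (Pi.single_nonneg.2 zero_le_one)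

theorem HasKraus.isStochastic_transition {Φ : SuperOp m n} (hΦ : HasKraus Φ) (h : IsTP Φ) :
    IsStochastic (transition Φ) := by
  refine ⟨fun i j => (Complex.le_def.1 (hΦ.posSemidef (posSemidef_single i)).diag_nonneg).1,
    fun i => ?_⟩
  have := congrArg Complex.re (h (Matrix.single i i 1))
  rw [Matrix.trace, Complex.re_sum] at this
  simpa [transition] using this

/-- Between two dephasings only populations matter. Taking real parts in `transition` loses nothing,
since diagonal entries of positive operators are real. -/
theorem dephase_comp_comp_dephase {Φ : SuperOp m n} (hΦ : HasKraus Φ) :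
    dephase n ∘ₗ Φ ∘ₗ dephase m = classicalMap (transition Φ) := by
  ext1 X
  rw [LinearMap.comp_apply, LinearMap.comp_apply, dephase_apply, dephase_apply, classicalMap_apply]
  congr 1
  funext j
  have hd : (Matrix.diagonal fun i => X i i) = ∑ i, X i i • Matrix.single i i (1 : ℂ) := by
    ext a b
    simp only [Matrix.sum_apply, Matrix.smul_apply, Matrix.single_apply, Matrix.diagonal_apply]
    split_ifs with hab
    · subst hab
      simp
    · refine (Finset.sum_eq_zero fun i _ => ?_).symm
      rw [if_neg, smul_zero]
      rintro ⟨rfl, rfl⟩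
      exact hab rfl
  have hre : ∀ i, Φ (Matrix.single i i 1) j j = (transition Φ i j : ℂ) := fun i => by
    have h := Complex.le_def.1
      ((hΦ.posSemidef (posSemidef_single i)).diag_nonneg (i := j))
    exact Complex.ext rfl (by simpa using h.2.symm)
  rw [hd, map_sum, Matrix.sum_apply]
  refine Finset.sum_congr rfl fun i _ => ?_
  rw [map_smul, Matrix.smul_apply, hre, smul_eq_mul, mul_comm]

theorem isDIO_classicalMap {P : m → m → ℝ} (h : IsStochastic P) : IsDIO (classicalMap P) := by
  refine ⟨h.isChannel, LinearMap.ext fun X => ?_⟩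
  simp only [LinearMap.comp_apply, classicalMap_apply, dephase_apply, Matrix.diagonal_apply_eq]

theorem IsDIO.comp {Φ Ψ : SuperOp m m} (hΦ : HasKraus Φ) (hΨ : HasKraus Ψ) (h1 : IsDIO Φ)
    (h2 : IsDIO Ψ) : IsDIO (Φ ∘ₗ Ψ) := by
  refine ⟨⟨(hΦ.comp hΨ).isCP, h1.1.2.comp h2.1.2⟩, ?_⟩
  calc dephase m ∘ₗ Φ ∘ₗ Ψ = (dephase m ∘ₗ Φ) ∘ₗ Ψ := rfl
    _ = (dephase m ∘ₗ Φ) ∘ₗ (dephase m ∘ₗ Ψ) := by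
      conv_lhs => rw [h1.2]
      rfl
    _ = (dephase m ∘ₗ Φ ∘ₗ dephase m) ∘ₗ (Ψ ∘ₗ dephase m) := by rw [h2.2]; rfl
    _ = dephase m ∘ₗ (Φ ∘ₗ Ψ) ∘ₗ dephase m := by rw [← h1.2]; rfl

theorem IsDIO.ampRight {Φ : SuperOp m m} (h : IsDIO Φ) : IsDIO (MeasRes.ampRight Φ p) := by
  refine ⟨⟨h.1.1.hasKraus.ampRight.isCP, h.1.2.ampRight⟩, LinearMap.ext fun X => ?_⟩
  simp only [LinearMap.comp_apply, dephase_apply]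
  congr 1
  funext x
  have h1 := congrFun (congrFun (LinearMap.congr_fun h.2
    (Matrix.of fun i j => X (i, x.2) (j, x.2))) x.1) x.1
  simp only [LinearMap.comp_apply, dephase_apply, Matrix.diagonal_apply_eq,
    Matrix.of_apply] at h1
  change Φ (Matrix.of fun i j => X (i, x.2) (j, x.2)) x.1 x.1 = Φ (Matrix.of fun i j =>
    (Matrix.diagonal fun i => X i i) (i, x.2) (j, x.2)) x.1 x.1
  rw [h1]
  refine congrFun (congrFun (congrArg Φ ?_) _) _
  ext i j
  simp [Matrix.diagonal_apply]

end Classical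

/-! ### Classical maps are LOCC, and LOCC maps are separable -/

section LOCC

variable {A B A' B' : Type} [Fintype A] [Fintype B] [Fintype A'] [Fintype B']

theorem isOneWayRight_sum {α : Type} [Fintype α] (Φ : α → SuperOp A A') (Ψ : α → SuperOp B B')
    (h1 : ∀ a, IsCP (Φ a)) (h2 : IsTP (∑ a, Φ a)) (h3 : ∀ a, IsChannel (Ψ a)) :
    IsOneWayRight (∑ a, tensor (Φ a) (Ψ a)) := by
  let e := (Fintype.equivFin α).symm
  refine ⟨_, fun a => Φ (e a), fun a => Ψ (e a), fun a => h1 _, ?_, fun a => h3 _, ?_⟩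
  · rwa [e.sum_comp Φ]
  · rw [e.sum_comp fun a => tensor (Φ a) (Ψ a)]

theorem isOneWayLeft_sum {α : Type} [Fintype α] (Φ : α → SuperOp A A') (Ψ : α → SuperOp B B')
    (h1 : ∀ a, IsChannel (Φ a)) (h2 : ∀ a, IsCP (Ψ a)) (h3 : IsTP (∑ a, Ψ a)) :
    IsOneWayLeft (∑ a, tensor (Φ a) (Ψ a)) := by
  let e := (Fintype.equivFin α).symm
  refine ⟨_, fun a => Φ (e a), fun a => Ψ (e a), fun a => h1 _, fun a => h2 _, ?_, ?_⟩
  · rwa [e.sum_comp Ψ]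
  · rw [e.sum_comp fun a => tensor (Φ a) (Ψ a)]

variable [DecidableEq A] [DecidableEq B] [DecidableEq A'] [DecidableEq B']

/-- Any measure-and-prepare map in the product basis is LOCC: one party announces its outcome, the
other samples the joint output and announces the first party's part. -/
theorem isLOCC_classicalMap {P : A × B → A' × B' → ℝ} (hP : IsStochastic P) :
    IsLOCC (classicalMap P) := by
  -- After the first round the first party keeps only a trivial system, and the second holds the
  -- sampled pair `A' × B'`; in the second round the label in `A'` is announced and recreated by the
  -- first party.
  set Φ₁ : A → SuperOp A Unit := fun a => classicalMap fun i _ => if i = a then 1 else 0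
  set Ψ₁ : A → SuperOp B (A' × B') := fun a => classicalMap fun j x => P (a, j) x
  set Φ₂ : A' → SuperOp Unit A' := fun a => classicalMap fun _ i => if a = i then 1 else 0
  set Ψ₂ : A' → SuperOp (A' × B') B' := fun a => classicalMap fun x j => if x = (a, j) then 1 else 0
  have h1 : IsOneWayRight (∑ a, tensor (Φ₁ a) (Ψ₁ a)) := by
    refine isOneWayRight_sum _ _ (fun a => (hasKraus_classicalMap fun i j => ?_).isCP) ?_ fun a =>
      IsStochastic.isChannel ⟨fun j x => hP.1 _ _, fun j => hP.2 _⟩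
    · positivity
    · rw [sum_classicalMap]
      exact isTP_classicalMap fun i => by simp
  have h2 : IsOneWayLeft (∑ a, tensor (Φ₂ a) (Ψ₂ a)) := by
    refine isOneWayLeft_sum _ _ (fun a => (isStochastic_ite _).isChannel)
      (fun a => (hasKraus_classicalMap fun i j => ?_).isCP) ?_
    · positivity
    · rw [sum_classicalMap]
      refine isTP_classicalMap fun x => ?_
      rw [Finset.sum_comm, ← Fintype.sum_prod_type' (fun a j => if x = (a, j) then (1 : ℝ) else 0)]
      simp
  have h3 : classicalMap P = (∑ a, tensor (Φ₂ a) (Ψ₂ a)) ∘ₗ ∑ a, tensor (Φ₁ a) (Ψ₁ a) := by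
    simp only [Φ₁, Φ₂, Ψ₁, Ψ₂, tensor_classicalMap]
    rw [sum_classicalMap, sum_classicalMap, classicalMap_comp]
    congr 1
    funext x y
    simp [Fintype.sum_prod_type, Prod.ext_iff, ite_and]
  rw [h3]
  exact IsLOCC.comp_left _ _ (IsLOCC.right _ h1) h2

/-- Measuring in the product basis and giving both parties the label is itself a deterministic
classical map. -/
theorem isLOCC_outcomeChannel_single {r : ℕ} (e : Fin r ≃ A × B) :
    IsLOCC (outcomeChannel fun x => Matrix.single (e x) (e x) (1 : ℂ)) := by
  have h : outcomeChannel (fun x => Matrix.single (e x) (e x) (1 : ℂ)) =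
      classicalMap fun i (y : Fin r × Fin r) => if (e.symm i, e.symm i) = y then 1 else 0 := by
    ext1 X
    change ∑ x, (Matrix.single (e x) (e x) (1 : ℂ) * X).trace • Matrix.single (x, x) (x, x) (1 : ℂ)
      = _
    rw [classicalMap_apply]
    ext y z
    simp only [Matrix.sum_apply, Matrix.smul_apply, Matrix.single_apply, Matrix.diagonal_apply,
      Matrix.trace_single_mul, one_mul, smul_eq_mul]
    rw [← e.sum_comp fun i => (((if (e.symm i, e.symm i) = y then 1 else 0 : ℝ) : ℂ) * X i i)]
    simp only [Equiv.symm_apply_apply]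
    split_ifs with hyz
    · subst hyz
      refine Finset.sum_congr rfl fun x _ => ?_
      by_cases hx : (x, x) = y <;> simp [hx]
    · refine Finset.sum_eq_zero fun x _ => ?_
      rw [if_neg, mul_zero]
      rintro ⟨rfl, rfl⟩
      exact hyz rfl
  rw [h]
  exact isLOCC_classicalMap (isStochastic_ite fun i => (e.symm i, e.symm i))

/-- Separable trace-preserving maps. -/
def IsSeparable {A B A' B' : Type} [Fintype A] [Fintype B] [Fintype A'] [Fintype B']
    (Λ : SuperOp (A × B) (A' × B')) : Prop :=
  IsTP Λ ∧ ∃ (κ : Type) (_ : Fintype κ) (K : κ → Matrix A' A ℂ) (L : κ → Matrix B' B ℂ),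
    Λ = krausMap fun k => K k ⊗ₖ L k

theorem IsSeparable.comp {A'' B'' : Type} [Fintype A''] [Fintype B''] [DecidableEq A'']
    [DecidableEq B''] {Γ : SuperOp (A' × B') (A'' × B'')} {Λ : SuperOp (A × B) (A' × B')}
    (hΓ : IsSeparable Γ) (hΛ : IsSeparable Λ) : IsSeparable (Γ ∘ₗ Λ) := by
  obtain ⟨t1, κ, _, K, L, rfl⟩ := hΓ
  obtain ⟨t2, κ', _, K', L', rfl⟩ := hΛ
  refine ⟨t1.comp t2, κ × κ', inferInstance, fun x => K x.1 * K' x.2, fun x => L x.1 * L' x.2, ?_⟩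
  rw [krausMap_comp]
  simp only [Matrix.mul_kronecker_mul]

theorem trace_tensor {Φ : SuperOp A A'} {Ψ : SuperOp B B'} (hΦ : HasKraus Φ) (hΨ : HasKraus Ψ)
    (X : Op (A × B)) :
    (tensor Φ Ψ X).trace = ((dual Φ 1 ⊗ₖ dual Ψ 1) * X).trace := by
  obtain ⟨κ, _, K, rfl⟩ := hΦ
  obtain ⟨κ', _, L, rfl⟩ := hΨ
  rw [tensor_krausMap, dual_krausMap, dual_krausMap, ← Matrix.one_mul (krausMap _ X),
    ← trace_krausAdj_mul]
  congr 2
  ext x y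
  simp [krausAdj_apply, Fintype.sum_prod_type, Matrix.conjTranspose_kronecker,
    ← Matrix.mul_kronecker_mul, Matrix.sum_apply, Finset.sum_mul_sum]

theorem isSeparable_sum_tensor {α : Type} [Fintype α] {Φ : α → SuperOp A A'}
    {Ψ : α → SuperOp B B'} (hΦ : ∀ a, HasKraus (Φ a)) (hΨ : ∀ a, HasKraus (Ψ a))
    (h : ∑ a, dual (Φ a) 1 ⊗ₖ dual (Ψ a) 1 = 1) : IsSeparable (∑ a, tensor (Φ a) (Ψ a)) := by
  constructor
  · intro X
    simp only [LinearMap.sum_apply, Matrix.trace_sum, trace_tensor (hΦ _) (hΨ _)]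
    rw [← Matrix.trace_sum, ← Finset.sum_mul, h, Matrix.one_mul]
  · choose κ hκ K hK using hΦ
    choose κ' hκ' L hL using hΨ
    refine ⟨Σ a, κ a × κ' a, inferInstance, fun x => K x.1 x.2.1, fun x => L x.1 x.2.2,
      LinearMap.ext fun X => ?_⟩
    simp [hK, hL, tensor_krausMap, krausMap_apply, Fintype.sum_sigma]

theorem IsOneWayRight.isSeparable {Λ : SuperOp (A × B) (A' × B')} (h : IsOneWayRight Λ) :
    IsSeparable Λ := by
  obtain ⟨r, Φ, Ψ, h1, h2, h3, rfl⟩ := h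
  refine isSeparable_sum_tensor (fun a => (h1 a).hasKraus) (fun a => (h3 a).1.hasKraus) ?_
  have h4 := dual_one h2
  rw [dual_sum_left] at h4
  simp only [dual_one (h3 _).2]
  rw [← Matrix.one_kronecker_one, ← h4]
  ext x y
  simp [Matrix.sum_apply, Finset.sum_mul]

theorem IsOneWayLeft.isSeparable {Λ : SuperOp (A × B) (A' × B')} (h : IsOneWayLeft Λ) :
    IsSeparable Λ := by
  obtain ⟨r, Φ, Ψ, h1, h2, h3, rfl⟩ := h
  refine isSeparable_sum_tensor (fun a => (h1 a).1.hasKraus) (fun a => (h2 a).hasKraus) ?_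
  have h4 := dual_one h3
  rw [dual_sum_left] at h4
  simp only [dual_one (h1 _).2]
  rw [← Matrix.one_kronecker_one, ← h4]
  ext x y
  simp [Matrix.sum_apply, Finset.mul_sum]

omit [DecidableEq A'] [DecidableEq B'] in
theorem IsLOCC.isSeparable {Λ : SuperOp (A × B) (A' × B')} (h : IsLOCC Λ) : IsSeparable Λ := by
  classical
  induction h with
  | right Λ h => exact h.isSeparable
  | left Λ h => exact h.isSeparable
  | comp_right Γ Λ _ h ih => exact h.isSeparable.comp ih
  | comp_left Γ Λ _ h ih => exact h.isSeparable.comp ih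

end LOCC

/-! ### The reduction criterion and its stability under closure -/

section Reduction

variable {m : Type} [Fintype m] [DecidableEq m]

theorem posSemidef_trace_sub {Q : Op m} (hQ : Q.PosSemidef) : (Q.trace • 1 - Q).PosSemidef := by
  have h : Q.trace • 1 - Q = eigU hQ.1 * Matrix.diagonal (fun i =>
      (((∑ j, hQ.1.eigenvalues j) - hQ.1.eigenvalues i : ℝ) : ℂ)) * (eigU hQ.1)ᴴ := by
    have h1 : (Matrix.diagonal fun i =>
        (((∑ j, hQ.1.eigenvalues j) - hQ.1.eigenvalues i : ℝ) : ℂ)) =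
        Q.trace • (1 : Op m) - Matrix.diagonal fun i => (hQ.1.eigenvalues i : ℂ) := by
      rw [hQ.1.trace_eq_sum_eigenvalues, Matrix.smul_one_eq_diagonal, Matrix.diagonal_sub]
      simp
    rw [h1, Matrix.mul_sub, Matrix.sub_mul, ← eq_eigU_diagonal, Matrix.mul_smul, Matrix.smul_mul,
      Matrix.mul_one, eigU_mul_conj]
  rw [h]
  refine (Matrix.PosSemidef.diagonal fun i => ?_).mul_mul_conjTranspose_same _
  rw [Pi.zero_apply, Complex.zero_le_real, sub_nonneg]
  exact Finset.single_le_sum (fun j _ => hQ.eigenvalues_nonneg j) (Finset.mem_univ i)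

theorem isClosed_posSemidef : IsClosed {M : Op m | M.PosSemidef} := by
  have h : {M : Op m | M.PosSemidef} = {M | Mᴴ = M} ∩ ⋂ x : m → ℂ,
      ({M | 0 ≤ (star x ⬝ᵥ M *ᵥ x).re} ∩ {M | 0 = (star x ⬝ᵥ M *ᵥ x).im}) := by
    ext M
    simp [Matrix.posSemidef_iff_dotProduct_mulVec, Matrix.IsHermitian, Complex.le_def]
  rw [h]
  refine (isClosed_eq (by fun_prop) continuous_id).inter (isClosed_iInter fun x => ?_)
  have hc : Continuous fun M : Op m => star x ⬝ᵥ M *ᵥ x :=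
    continuous_const.dotProduct (continuous_id.matrix_mulVec continuous_const)
  exact (isClosed_le continuous_const (Complex.continuous_re.comp hc)).inter
    (isClosed_eq continuous_const (Complex.continuous_im.comp hc))

variable {A B : Type} [Fintype A] [Fintype B] [DecidableEq A] [DecidableEq B]

/-- The operator `tr_B Y ⊗ 1`. -/
def traceOutRight (Y : Op (A × B)) : Op (A × B) :=
  Matrix.of fun p q => if p.2 = q.2 then ∑ b, Y (p.1, b) (q.1, b) else 0

theorem traceOutRight_kronecker (P : Op A) (Q : Op B) :
    traceOutRight (P ⊗ₖ Q) = P ⊗ₖ (Q.trace • (1 : Op B)) := by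
  ext p q
  simp only [traceOutRight, Matrix.of_apply, Matrix.kroneckerMap_apply, Matrix.smul_apply,
    Matrix.one_apply, smul_eq_mul, ← Finset.mul_sum]
  split_ifs <;> simp [Matrix.trace]

theorem traceOutRight_sum {ι : Type} (s : Finset ι) (Y : ι → Op (A × B)) :
    traceOutRight (∑ i ∈ s, Y i) = ∑ i ∈ s, traceOutRight (Y i) := by
  ext p q
  simp only [traceOutRight, Matrix.of_apply, Matrix.sum_apply]
  split_ifs
  · exact Finset.sum_comm
  · simp

/-- Each Kraus term pulls the product effect `|x⟩⟨x|` back to a positive product `P ⊗ Q`, for which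
the difference is `P ⊗ (tr Q • 1 - Q)`. -/
theorem IsSeparable.reduction {Λ : SuperOp (A × B) (A × B)} (h : IsSeparable Λ) (x : A × B) :
    (traceOutRight (dual Λ (Matrix.single x x 1)) - dual Λ (Matrix.single x x 1)).PosSemidef := by
  obtain ⟨_, κ, _, K, L, rfl⟩ := h
  have hx : Matrix.single x x (1 : ℂ) =
      Matrix.single x.1 x.1 (1 : ℂ) ⊗ₖ Matrix.single x.2 x.2 (1 : ℂ) := by
    rw [Matrix.single_kronecker_single, mul_one]
  have hsub : ∀ (P : Op A) (Q R : Op B), P ⊗ₖ Q - P ⊗ₖ R = P ⊗ₖ (Q - R) := fun P Q R => by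
    ext
    simp [mul_sub]
  rw [dual_krausMap, krausAdj_apply, traceOutRight_sum, ← Finset.sum_sub_distrib]
  refine Matrix.posSemidef_sum _ fun k _ => ?_
  rw [hx, Matrix.conjTranspose_kronecker, ← Matrix.mul_kronecker_mul, ← Matrix.mul_kronecker_mul,
    traceOutRight_kronecker, hsub]
  exact ((posSemidef_single x.1).conjTranspose_mul_mul_same _).kronecker
    (posSemidef_trace_sub ((posSemidef_single x.2).conjTranspose_mul_mul_same _))

/-- These are the only facts about LOCC used in the lower bound. They are closed conditions, so they
pass from LOCC channels to limits without a limiting Kraus form. -/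
theorem IsClosureLOCC.props {F : SuperOp (A × B) (A × B)} (hF : IsClosureLOCC F) :
    IsTP F ∧ ∀ x, (dual F (Matrix.single x x 1)).PosSemidef ∧
      (traceOutRight (dual F (Matrix.single x x 1)) - dual F (Matrix.single x x 1)).PosSemidef := by
  -- The closure lives in the space of all functions, so the adjoint on basis effects is first
  -- expressed through finitely many values of a possibly nonlinear `G`.
  set R : (A × B) → (Op (A × B) → Op (A × B)) → Op (A × B) := fun x G =>
    Matrix.of fun p q => G (Matrix.single q p 1) x x with hR
  have hRF : ∀ (G : SuperOp (A × B) (A × B)) x, R x G = dual G (Matrix.single x x 1) := by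
    intro G x
    ext p q
    rw [dual_single_apply]
    rfl
  have hcont : ∀ p q x y, Continuous fun G : Op (A × B) → Op (A × B) =>
      G (Matrix.single q p 1) x y := fun p q x y =>
    (continuous_apply_apply x y).comp (continuous_apply (Matrix.single q p (1 : ℂ)))
  have hRc : ∀ x, Continuous (R x) := fun x =>
    continuous_pi fun p => continuous_pi fun q => hcont p q x x
  have hTc : Continuous (traceOutRight : Op (A × B) → Op (A × B)) := by
    refine continuous_pi fun p => continuous_pi fun q => ?_
    change Continuous fun Y : Op (A × B) => if p.2 = q.2 then ∑ b, Y (p.1, b) (q.1, b) else 0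
    split_ifs
    · exact continuous_finsetSum _ fun b _ => continuous_apply_apply _ _
    · exact continuous_const
  set S : Set (Op (A × B) → Op (A × B)) := (⋂ X, {G | (G X).trace = X.trace}) ∩
    ⋂ x, ({G | (R x G).PosSemidef} ∩ {G | (traceOutRight (R x G) - R x G).PosSemidef}) with hS
  have hclosed : IsClosed S := by
    refine (isClosed_iInter fun X => isClosed_eq ?_ continuous_const).inter
      (isClosed_iInter fun x => (isClosed_posSemidef.preimage (hRc x)).inter
        (isClosed_posSemidef.preimage ((hTc.comp (hRc x)).sub (hRc x))))
    exact (Continuous.matrix_trace continuous_id).comp (continuous_apply X)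
  have hsub : closure {G | ∃ Λ : SuperOp (A × B) (A × B), IsLOCC Λ ∧ G = ⇑Λ} ⊆ S := by
    refine closure_minimal ?_ hclosed
    rintro _ ⟨Λ, hΛ, rfl⟩
    have hs := hΛ.isSeparable
    refine ⟨Set.mem_iInter.2 hs.1, Set.mem_iInter.2 fun x => ⟨?_, ?_⟩⟩
    · rw [Set.mem_ofPred_eq, hRF]
      obtain ⟨_, κ, _, K, L, rfl⟩ := hs
      exact (hasKraus_krausMap _).dual_posSemidef (posSemidef_single x)
    · rw [Set.mem_ofPred_eq, hRF]
      exact hs.reduction x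
  have hF' := hsub hF
  refine ⟨Set.mem_iInter.1 hF'.1, fun x => ?_⟩
  have := Set.mem_iInter.1 hF'.2 x
  rwa [Set.mem_inter_iff, Set.mem_ofPred_eq, Set.mem_ofPred_eq, hRF] at this

end Reduction

/-! ### Extended-valued relative entropy -/

section RelEntropy

variable {m n : Type} [Fintype m] [DecidableEq m] [Fintype n] [DecidableEq n]
  {ι : Type} [Fintype ι]

theorem krausDefect_posSemidef {κ : Type} [Fintype κ] (K : κ → Matrix n m ℂ) {c : ℝ}
    (h : ∀ W : Op m, W.PosSemidef → (krausMap K W).trace ≤ c * W.trace) :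
    (krausDefect K c).PosSemidef := by
  refine Matrix.posSemidef_iff_dotProduct_mulVec.2 ⟨krausDefect_isHermitian K c, fun v => ?_⟩
  have h1 := h _ (Matrix.posSemidef_vecMulVec_self_star v)
  rw [← sub_nonneg, ← trace_krausDefect_mul, Matrix.mul_vecMulVec, Matrix.trace_vecMulVec,
    dotProduct_comm] at h1
  exact h1

/-- The data processing inequality for a family of trace-nonincreasing completely positive maps,
up to scaling factors `c i`. -/
theorem relEnt_sum_le {Φ : ι → SuperOp m n} (hΦ : ∀ i, HasKraus (Φ i)) {X Y : ι → Op m}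
    (hX : ∀ i, (X i).PosSemidef) (hY : ∀ i, (Y i).PosSemidef) {c : ι → ℝ} (hc : ∀ i, 0 ≤ c i)
    (hle : ∀ i, ∀ W : Op m, W.PosSemidef → (Φ i W).trace ≤ c i * W.trace)
    (htr : ∀ i, (Φ i (X i)).trace = c i * (X i).trace) (h : ∀ i, SuppLE (X i) (Y i)) :
    SuppLE (∑ i, Φ i (X i)) (∑ i, Φ i (Y i)) ∧
      relEnt (∑ i, Φ i (X i)) (∑ i, Φ i (Y i)) ≤ ∑ i, c i * relEnt (X i) (Y i) := by
  choose κ hκ K hK using hΦ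
  obtain rfl : Φ = fun i => krausMap (K i) := funext hK
  exact ⟨suppLE_sum_krausMap K hY h,
    relEnt_sum_krausMap_le K hX hY hc (fun i => krausDefect_posSemidef (K i) (hle i)) htr h⟩

/-- Subadditivity for the two pairs `(X, Y)` and `(0, R)`, the second of which contributes nothing.
-/
theorem relEnt_mono_right {X Y R : Op m} (hX : X.PosSemidef) (hY : Y.PosSemidef)
    (hR : R.PosSemidef) (h : SuppLE X Y) :
    SuppLE X (Y + R) ∧ relEnt X (Y + R) ≤ relEnt X Y := by
  have := relEnt_sum_le (ι := Bool) (Φ := fun _ => (LinearMap.id : SuperOp m m))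
    (fun _ => hasKraus_id) (X := fun b => if b then X else 0) (Y := fun b => if b then Y else R)
    (c := fun _ => 1) (fun b => by cases b <;> simp [hX, Matrix.PosSemidef.zero])
    (fun b => by cases b <;> simp [hY, hR]) (fun _ => zero_le_one) (fun _ W _ => by simp)
    (fun _ => by simp) (fun b => by cases b <;> simp [h, suppLE_zero_left])
  simpa [relEnt_zero_left] using this

theorem relEntropy_ne_bot (X Y : Op m) : relEntropy X Y ≠ ⊥ := by
  unfold relEntropy
  split_ifs
  · exact EReal.coe_ne_bot _
  · exact bot_lt_top.ne'

theorem sum_relEntropy_of_suppLE {X Y : ι → Op m} (h : ∀ i, SuppLE (X i) (Y i)) :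
    ∑ i, relEntropy (X i) (Y i) = ((∑ i, relEnt (X i) (Y i) : ℝ) : EReal) := by
  simp only [relEntropy_of_suppLE (h _)]
  exact (map_sum (⟨⟨Real.toEReal, EReal.coe_zero⟩, EReal.coe_add⟩ : ℝ →+ EReal) _ _).symm

/-- One infinite term suffices only because no other term is `⊥`, which would absorb `⊤` in `EReal`.
-/
theorem sum_relEntropy_eq_top {X Y : ι → Op m} (h : ∃ i, ¬ SuppLE (X i) (Y i)) :
    ∑ i, relEntropy (X i) (Y i) = ⊤ := by
  classical
  obtain ⟨i, hi⟩ := h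
  have hbot : ∀ s : Finset ι, ∑ j ∈ s, relEntropy (X j) (Y j) ≠ ⊥ := by
    intro s
    induction s using Finset.induction_on with
    | empty => simp
    | insert a s ha ih =>
      rw [Finset.sum_insert ha]
      exact fun h => (EReal.add_eq_bot_iff.1 h).elim (relEntropy_ne_bot _ _) ih
  rw [← Finset.add_sum_erase _ _ (Finset.mem_univ i), relEntropy_of_not_suppLE hi]
  exact EReal.top_add_of_ne_bot (hbot _)

theorem relEntropy_pullback_le {X Y : Op m} (hX : X.PosSemidef) (hY : Y.PosSemidef) (e : n ≃ m) :
    relEntropy (pullback e X) (pullback e Y) ≤ relEntropy X Y := by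
  by_cases h : SuppLE X Y
  · have := relEnt_sum_le (ι := Unit) (Φ := fun _ => pullback e) (fun _ => hasKraus_pullback e)
      (fun _ => hX) (fun _ => hY) (c := fun _ => 1) (fun _ => zero_le_one)
      (fun _ W _ => by rw [isTP_pullback]; simp) (fun _ => by rw [isTP_pullback]; simp)
      (fun _ => h)
    simp only [Finset.univ_unique, Finset.sum_singleton, one_mul] at this
    rw [relEntropy_of_suppLE h, relEntropy_of_suppLE this.1]
    exact EReal.coe_le_coe_iff.2 this.2
  · rw [relEntropy_of_not_suppLE h]
    exact le_top

end RelEntropy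

/-! ### Optimality of the incoherent basis measurement -/

section BasisRel

variable {A R n : Type} [Fintype A] [DecidableEq A] [Fintype R] [DecidableEq R]
  [Fintype n] [DecidableEq n]

/-- The relative entropy of two channels measured in the incoherent basis without ancilla. -/
def basisRelEntropy (E F : SuperOp A A) : EReal :=
  ((1 / (Fintype.card A : ℝ) : ℝ) : EReal) *
    ∑ i, relEntropy (dual E (Matrix.single i i 1)) (dual F (Matrix.single i i 1))

/-- Tensoring with a fixed operator on the right. -/
def attach (A : Type) (G : Op R) : SuperOp A (A × R) where
  toFun X := X ⊗ₖ G
  map_add' X Y := Matrix.add_kronecker X Y G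
  map_smul' c X := Matrix.smul_kronecker c X G

theorem hasKraus_attach {G : Op R} (hG : G.PosSemidef) : HasKraus (attach A G) := by
  obtain ⟨B, rfl⟩ := exists_eq_conjTranspose_mul_self hG
  refine ⟨R, inferInstance, fun r => Matrix.of fun x a => if x.1 = a then star (B r x.2) else 0,
    LinearMap.ext fun X => ?_⟩
  ext x y
  simp [attach, krausMap_apply, Matrix.sum_apply, Matrix.mul_apply, Finset.mul_sum,
    apply_ite (starRingEnd ℂ)]
  exact Finset.sum_congr rfl fun r _ => by ring

/-- The diagonal blocks of an operator with respect to the first factor. -/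
def diagBlock (N : Op (A × R)) (i : A) : Op R := N.submatrix (fun s => (i, s)) fun s => (i, s)

theorem dual_ampRight_kronecker {E : SuperOp A A} (hE : HasKraus E) (P : Op A) (G : Op R) :
    dual (ampRight E R) (P ⊗ₖ G) = dual E P ⊗ₖ G := by
  obtain ⟨κ, _, K, rfl⟩ := hE
  rw [ampRight_krausMap, dual_krausMap, dual_krausMap]
  ext x y
  simp [krausAdj_apply, Matrix.conjTranspose_kronecker, ← Matrix.mul_kronecker_mul,
    Matrix.sum_apply, Finset.sum_mul]

theorem eq_sum_kronecker_diagBlock {N : Op (A × R)} (hN : ∀ p q, p.1 ≠ q.1 → N p q = 0) :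
    N = ∑ i, Matrix.single i i (1 : ℂ) ⊗ₖ diagBlock N i := by
  ext p q
  simp only [Matrix.sum_apply, Matrix.kroneckerMap_apply, Matrix.single_apply, diagBlock,
    Matrix.submatrix_apply]
  rw [Finset.sum_eq_single p.1 (fun i _ hi => by rw [if_neg fun h => hi h.1, zero_mul]) (by simp)]
  by_cases h : p.1 = q.1
  · rw [if_pos ⟨rfl, h⟩, one_mul]
    exact congrArg (N p) (Prod.ext h.symm rfl)
  · rw [if_neg fun h' => h h'.2, zero_mul, hN p q h]

/-- Measurements that are block-diagonal in the incoherent basis of `A` distinguish two channels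
no better than the basis measurement, also after a trace-preserving completely positive map. -/
theorem measRelEntropy_le_basisRelEntropy {E F : SuperOp A A} (hE : HasKraus E) (hF : HasKraus F)
    {r : ℕ} {N : Fin r → Op (A × R)} (hN : IsPOVM N)
    (hblock : ∀ x p q, p.1 ≠ q.1 → N x p q = 0) {Θ : SuperOp (A × R) n} (hΘ : HasKraus Θ)
    (hTP : IsTP Θ) (hcard : Fintype.card n = Fintype.card (A × R)) [Nonempty A] [Nonempty R] :
    measRelEntropy (fun x => Θ (dual (ampRight E R) (N x)))
      (fun x => Θ (dual (ampRight F R) (N x))) ≤ basisRelEntropy E F := by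
  have hA : (0 : ℝ) < Fintype.card A := by exact_mod_cast Fintype.card_pos
  have hR : (0 : ℝ) < Fintype.card R := by exact_mod_cast Fintype.card_pos
  by_cases hs : ∀ i, SuppLE (dual E (Matrix.single i i 1)) (dual F (Matrix.single i i 1))
  swap
  · rw [basisRelEntropy, sum_relEntropy_eq_top (not_forall.1 hs),
      EReal.coe_mul_top_of_pos (by positivity)]
    exact le_top
  set G : Fin r → A → Op R := fun x i => diagBlock (N x) i with hG
  have hGpos : ∀ x i, (G x i).PosSemidef := fun x i => (hN.1 x).submatrix _
  -- Each transformed effect is a sum over `i` of images of `E†(|i⟩⟨i|)` under maps that do not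
  -- depend on `E`, which is the setting of `relEnt_sum_le`.
  have hdec : ∀ {E : SuperOp A A}, HasKraus E → ∀ x, Θ (dual (ampRight E R) (N x)) =
      ∑ i, (Θ ∘ₗ attach A (G x i)) (dual E (Matrix.single i i 1)) := by
    intro E hE x
    conv_lhs => rw [eq_sum_kronecker_diagBlock (hblock x), dual_sum, map_sum]
    exact Finset.sum_congr rfl fun i _ => congrArg Θ (dual_ampRight_kronecker hE _ _)
  have htrG : ∀ x i, (G x i).trace = ((G x i).trace.re : ℂ) := fun x i => by
    have := Complex.le_def.1 (hGpos x i).trace_nonneg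
    exact Complex.ext rfl (by simpa using this.2.symm)
  have htr : ∀ x i (W : Op A),
      ((Θ ∘ₗ attach A (G x i)) W).trace = ((G x i).trace.re : ℂ) * W.trace := fun x i W => by
    rw [← htrG, LinearMap.comp_apply, hTP, mul_comm]
    exact Matrix.trace_kronecker _ _
  have hmain := fun x => relEnt_sum_le (Φ := fun i => Θ ∘ₗ attach A (G x i))
    (X := fun i => dual E (Matrix.single i i 1)) (Y := fun i => dual F (Matrix.single i i 1))
    (c := fun i => (G x i).trace.re)
    (fun i => hΘ.comp (hasKraus_attach (hGpos x i)))
    (fun i => hE.dual_posSemidef (posSemidef_single i))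
    (fun i => hF.dual_posSemidef (posSemidef_single i))
    (fun i => (Complex.le_def.1 (hGpos x i).trace_nonneg).1)
    (fun i W _ => (htr x i W).le) (fun i => htr x i _) hs
  -- Completeness of the POVM on each diagonal block. The resulting factor `dim R` is cancelled by
  -- the normalization `1 / (dim A * dim R)`.
  have hsum : ∀ i, ∑ x, (G x i).trace.re = Fintype.card R := by
    intro i
    rw [← Complex.re_sum, ← Matrix.trace_sum]
    have : ∑ x, G x i = 1 := by
      have h1 : diagBlock (∑ x, N x) i = ∑ x, G x i := by
        ext
        simp [hG, diagBlock, Matrix.sum_apply]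
      rw [← h1, hN.2]
      ext
      simp [diagBlock, Matrix.one_apply]
    rw [this, Matrix.trace_one, Complex.natCast_re]
  rw [measRelEntropy, basisRelEntropy, sum_relEntropy_of_suppLE hs, sum_relEntropy_of_suppLE]
  · rw [← EReal.coe_mul, ← EReal.coe_mul, EReal.coe_le_coe_iff, hcard, Fintype.card_prod]
    have h1 : ∑ x, relEnt (Θ (dual (ampRight E R) (N x))) (Θ (dual (ampRight F R) (N x))) ≤
        Fintype.card R *
          ∑ i, relEnt (dual E (Matrix.single i i 1)) (dual F (Matrix.single i i 1)) := by
      refine (Finset.sum_le_sum fun x _ => ?_).trans_eq (b := ∑ x, ∑ i, (G x i).trace.re *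
        relEnt (dual E (Matrix.single i i 1)) (dual F (Matrix.single i i 1))) ?_
      · rw [hdec hE, hdec hF]
        exact (hmain x).2
      · rw [Finset.sum_comm, Finset.mul_sum]
        refine Finset.sum_congr rfl fun i _ => ?_
        rw [← Finset.sum_mul, hsum]
    refine (mul_le_mul_of_nonneg_left h1 (by positivity)).trans_eq ?_
    push_cast
    field_simp
  · intro x
    rw [hdec hE, hdec hF]
    exact (hmain x).1

/-- Restriction to overlapping subspaces followed by an increase of the second argument. -/
theorem relEnt_le_of_pullback {J : Type} [Fintype J] [Nonempty J] (f : J → A → n)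
    (hf : ∀ j, Function.Injective (f j)) {X Y : J → Op n} (hX : ∀ j, (X j).PosSemidef)
    (hY : ∀ j, (Y j).PosSemidef) {V W : Op A} (hV : ∀ j, pullback (f j) (X j) = V)
    (htr : ∀ j, (X j).trace = V.trace)
    (hW : (W - ∑ j, ((1 / Fintype.card J : ℝ) : ℂ) • pullback (f j) (Y j)).PosSemidef)
    (h : ∀ j, SuppLE (X j) (Y j)) :
    SuppLE V W ∧ relEnt V W ≤ ∑ j, 1 / (Fintype.card J : ℝ) * relEnt (X j) (Y j) := by
  have hJ : (0 : ℝ) < Fintype.card J := by exact_mod_cast Fintype.card_pos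
  set c : ℝ := 1 / Fintype.card J with hc
  have hc0 : 0 ≤ c := by positivity
  -- Injectivity of `f j` makes the restriction a compression, which only discards nonnegative
  -- diagonal entries. By `hV` and `htr` nothing is lost on `X j`.
  have htrace : ∀ j (Z : Op n), Z.PosSemidef → (pullback (f j) Z).trace ≤ Z.trace := by
    intro j Z hZ
    change ∑ a, Z (f j a) (f j a) ≤ ∑ b, Z b b
    rw [← Finset.sum_image (s := Finset.univ) (g := f j) (f := fun b => Z b b)
      fun a _ b _ hab => hf j hab]
    exact Finset.sum_le_sum_of_subset_of_nonneg (Finset.subset_univ _)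
      fun b _ _ => hZ.diag_nonneg
  obtain ⟨h1, h2⟩ := relEnt_sum_le (Φ := fun j => (c : ℂ) • pullback (f j))
    (fun j => (hasKraus_pullback (f j)).smul hc0) hX hY (c := fun _ => c) (fun _ => hc0)
    (fun j Z hZ => by
      rw [LinearMap.smul_apply, Matrix.trace_smul, smul_eq_mul]
      exact mul_le_mul_of_nonneg_left (htrace j Z hZ) (Complex.zero_le_real.2 hc0))
    (fun j => by rw [LinearMap.smul_apply, Matrix.trace_smul, smul_eq_mul, hV, htr]) h
  have hVsum : ∑ j, ((c : ℂ) • pullback (f j)) (X j) = V := by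
    simp only [LinearMap.smul_apply, hV, Finset.sum_const, Finset.card_univ]
    rw [← Nat.cast_smul_eq_nsmul ℂ, smul_smul, hc]
    push_cast
    rw [mul_one_div_cancel (by exact_mod_cast hJ.ne'), one_smul]
  rw [hVsum] at h1 h2
  have hVpos : V.PosSemidef := by
    rw [← hV (Classical.arbitrary J)]
    exact (hX _).submatrix _
  have hYpos : (∑ j, ((c : ℂ) • pullback (f j)) (Y j)).PosSemidef :=
    Matrix.posSemidef_sum _ fun j _ =>
      ((hasKraus_pullback (f j)).smul hc0).posSemidef (hY j)
  -- `W` exceeds the average of the restricted `Y j` by the positive operator in `hW`.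
  have h3 := relEnt_mono_right hVpos hYpos hW h1
  simp only [LinearMap.smul_apply] at h3 h2
  rw [add_sub_cancel] at h3
  exact ⟨h3.1, h3.2.trans h2⟩

end BasisRel

/-! ### Basis measurements and the closure of LOCC measurements -/

section BasisMeasurement

variable {m A B : Type} [Fintype m] [DecidableEq m] [Fintype A] [Fintype B] [DecidableEq A]
  [DecidableEq B]

theorem isPOVM_single {r : ℕ} (e : Fin r ≃ m) :
    IsPOVM fun x => Matrix.single (e x) (e x) (1 : ℂ) := by
  refine ⟨fun x => posSemidef_single _, ?_⟩
  rw [e.sum_comp fun i => Matrix.single i i (1 : ℂ)]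
  ext a b
  simp only [Matrix.sum_apply, Matrix.single_apply, Matrix.one_apply]
  split_ifs with h
  · subst h
    simp
  · refine Finset.sum_eq_zero fun i _ => if_neg ?_
    rintro ⟨rfl, rfl⟩
    exact h rfl

theorem isIncoherentMeas_single {r : ℕ} (e : Fin r ≃ m) :
    IsIncoherentMeas fun x => Matrix.single (e x) (e x) (1 : ℂ) := by
  refine ⟨isPOVM_single e, fun x => ?_⟩
  rw [dephase_apply]
  ext a b
  dsimp only
  rw [Matrix.diagonal_apply]
  split_ifs with h
  · rw [h]
  · rw [Matrix.single_apply, if_neg]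
    rintro ⟨rfl, rfl⟩
    exact h rfl

theorem isLOCCMeas_single {r : ℕ} (e : Fin r ≃ A × B) :
    IsLOCCMeas fun x => Matrix.single (e x) (e x) (1 : ℂ) :=
  ⟨isPOVM_single e, isLOCC_outcomeChannel_single e⟩

theorem measRelEntropy_single {n : Type} [Fintype n] [DecidableEq n] {r : ℕ} (e : Fin r ≃ n)
    (Φ Ψ : SuperOp m n) :
    measRelEntropy (preprocess (fun x => Matrix.single (e x) (e x) (1 : ℂ)) Φ)
      (preprocess (fun x => Matrix.single (e x) (e x) (1 : ℂ)) Ψ) =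
    ((1 / (Fintype.card m : ℝ) : ℝ) : EReal) *
      ∑ i, relEntropy (dual Φ (Matrix.single i i 1)) (dual Ψ (Matrix.single i i 1)) := by
  rw [measRelEntropy]
  congr 1
  exact e.sum_comp fun i => relEntropy (dual Φ (Matrix.single i i 1)) (dual Ψ (Matrix.single i i 1))

theorem isPOVM_of_isClosureLOCCMeas {r : ℕ} {M : Fin r → Op (A × B)} (h : IsClosureLOCCMeas M) :
    IsPOVM M := by
  have hc : IsClosed {N : Fin r → Op (A × B) | IsPOVM N} := by
    have : {N : Fin r → Op (A × B) | IsPOVM N} =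
        (⋂ x, {N | (N x).PosSemidef}) ∩ {N | ∑ x, N x = 1} := by
      ext N
      simp [IsPOVM]
    rw [this]
    have hx : ∀ x, Continuous fun N : Fin r → Op (A × B) => N x := continuous_apply
    exact (isClosed_iInter fun x => isClosed_posSemidef.preimage (hx x)).inter
      (isClosed_eq (continuous_finsetSum _ fun x _ => hx x) continuous_const)
  exact closure_minimal (fun N hN => hN.1) hc h

/-- Dephasing of `AB` kills matrix units that are off-diagonal in `A`, whatever the ancillas carry;
this supplies the block structure in the upper bound. -/
theorem dual_ampBipartite_dephase_apply_eq_zero {S T : Type} [Fintype S] [Fintype T]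
    [DecidableEq S] [DecidableEq T] (Y : Op ((A × S) × (B × T))) {p q : (A × S) × (B × T)}
    (h : p.1.1 ≠ q.1.1) : dual (ampBipartite (dephase (A × B)) S T) Y p q = 0 := by
  have h0 : ampBipartite (dephase (A × B)) S T (Matrix.single q p (1 : ℂ)) = 0 := by
    ext x y
    change Matrix.diagonal (fun i : A × B =>
      (Matrix.single q p (1 : ℂ)) ((i.1, x.1.2), (i.2, x.2.2)) ((i.1, y.1.2), (i.2, y.2.2))) _ _ = 0
    rw [Matrix.diagonal_apply]
    split_ifs
    · rw [Matrix.single_apply, if_neg]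
      rintro ⟨rfl, rfl⟩
      exact h rfl
    · rfl
  rw [dual, Matrix.of_apply, h0, Matrix.mul_zero, Matrix.trace_zero]

end BasisMeasurement

/-! ### Upper bound: entangling power is at most cohering power -/

section Upper

variable {A B : Type} [Fintype A] [Fintype B] [DecidableEq A] [DecidableEq B]

/-- The basis measurement with a one-dimensional ancilla is an admissible incoherent measurement. -/
theorem basisRelEntropy_le_iSup [Nonempty A] {E F : SuperOp A A} (hE : HasKraus E)
    (hF : HasKraus F) :
    basisRelEntropy E F ≤
      ⨆ (k : ℕ) (_ : 1 ≤ k) (r : ℕ) (M : Fin r → Op (A × Fin k)) (_ : IsIncoherentMeas M),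
        measRelEntropy (preprocess M (ampRight E (Fin k))) (preprocess M (ampRight F (Fin k))) := by
  let e := (Fintype.equivFin (A × Fin 1)).symm
  refine le_iSup_of_le 1 (le_iSup_of_le le_rfl (le_iSup_of_le _ (le_iSup_of_le _
    (le_iSup_of_le (isIncoherentMeas_single e) ?_))))
  rw [measRelEntropy_single, basisRelEntropy]
  have hcard : Fintype.card (A × Fin 1) = Fintype.card A := by simp
  rw [hcard]
  refine mul_le_mul_of_nonneg_left ?_ (by positivity)
  rw [Fintype.sum_prod_type]
  refine Finset.sum_le_sum fun i _ => ?_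
  rw [Fintype.sum_unique]
  have hd : ∀ {E : SuperOp A A}, dual E (Matrix.single i i 1) =
      pullback (Equiv.prodUnique A (Fin 1)).symm
        (dual (ampRight E (Fin 1)) (Matrix.single (i, default) (i, default) 1)) := by
    intro E
    ext a b
    rw [pullback_apply, Matrix.submatrix_apply, dual_single_apply, dual_single_apply]
    refine congrFun (congrFun (congrArg E ?_) i) i
    ext k l
    simp [Matrix.single_apply]
  rw [hd, hd]
  exact relEntropy_pullback_le (hE.ampRight.dual_posSemidef (posSemidef_single _))
    (hF.ampRight.dual_posSemidef (posSemidef_single _)) _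

theorem entanglingPower_le_coheringPower [Nonempty A] [Nonempty B] {E : SuperOp A A}
    (hE : IsChannel E) {K L : SuperOp (A × B) (A × B)} (hK : IsDIO K) (hL : IsDIO L)
    (hLu : IsUnital L) :
    entanglingPower (dephase (A × B) ∘ₗ K ∘ₗ ampRight E B ∘ₗ L) ≤ coheringPower E := by
  refine le_iInf₂ fun F hF => ?_
  have kE := hE.1.hasKraus
  have kF := hF.1.1.hasKraus
  have kK := hK.1.1.hasKraus
  have kL := hL.1.1.hasKraus
  refine le_trans ?_ (basisRelEntropy_le_iSup kE kF)
  have hKFL : IsDIO (K ∘ₗ ampRight F B ∘ₗ L) :=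
    IsDIO.comp kK (kF.ampRight.comp kL) hK (IsDIO.comp kF.ampRight kL hF.ampRight hL)
  -- Because `K ∘ (F ⊗ id) ∘ L` is DIO, a second dephasing can be inserted at the input, so the
  -- competitor is a classical map.
  have hclosure : IsClosureLOCC (dephase (A × B) ∘ₗ K ∘ₗ ampRight F B ∘ₗ L) := by
    refine subset_closure ⟨_, ?_, rfl⟩
    rw [hKFL.2, dephase_comp_comp_dephase hKFL.1.1.hasKraus]
    exact isLOCC_classicalMap (hKFL.1.1.hasKraus.isStochastic_transition hKFL.1.2)
  refine iInf₂_le_of_le _ hclosure ?_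
  refine iSup_le fun s => iSup_le fun hs => iSup_le fun t => iSup_le fun ht => iSup_le fun r =>
    iSup_le fun M => iSup_le fun hM => ?_
  have hPOVM := isPOVM_of_isClosureLOCCMeas hM
  have : Nonempty (Fin s) := ⟨⟨0, hs⟩⟩
  have : Nonempty (Fin t) := ⟨⟨0, ht⟩⟩
  set e := Equiv.prodAssoc A (Fin s) (B × Fin t)
  set DK : SuperOp (A × B) (A × B) := dephase (A × B) ∘ₗ K with hDK
  have kDK : HasKraus (ampBipartite DK (Fin s) (Fin t)) := (hasKraus_dephase.comp kK).ampBipartite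
  have tDK : IsTP (ampBipartite DK (Fin s) (Fin t)) := (isTP_dephase.comp hK.1.2).ampBipartite
  -- `Δ ∘ K` is absorbed into the POVM, `L†` into the later map `Θ`, and everything except `A`
  -- becomes a single ancilla.
  set N : Fin r → Op (A × (Fin s × B × Fin t)) := fun x =>
    pullback e.symm (dual (ampBipartite DK (Fin s) (Fin t)) (M x)) with hN
  set Θ : SuperOp (A × (Fin s × B × Fin t)) ((A × Fin s) × (B × Fin t)) :=
    dualHom (ampBipartite L (Fin s) (Fin t)) ∘ₗ pullback e with hΘ
  have hdec : ∀ (E : SuperOp A A), preprocess M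
      (ampBipartite (dephase (A × B) ∘ₗ K ∘ₗ ampRight E B ∘ₗ L) (Fin s) (Fin t)) =
      fun x => Θ (dual (ampRight E (Fin s × B × Fin t)) (N x)) := by
    intro E
    funext x
    change dual ((ampBipartite DK (Fin s) (Fin t) ∘ₗ ampBipartite (ampRight E B) (Fin s) (Fin t)) ∘ₗ
      ampBipartite L (Fin s) (Fin t)) (M x) = _
    rw [dual_comp, dual_comp, ampBipartite_ampRight, dual_comp, dual_comp, dual_pullback,
      dual_pullback]
    rfl
  rw [hdec, hdec]
  refine measRelEntropy_le_basisRelEntropy kE kF ⟨fun x => ?_, ?_⟩ ?_ ?_ ?_ ?_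
  · exact (kDK.dual_posSemidef (hPOVM.1 x)).submatrix _
  · rw [hN, ← map_sum, ← dual_sum, hPOVM.2, dual_one tDK, pullback_apply]
    simp
  · intro x p q hpq
    have h1 : DK = DK ∘ₗ dephase (A × B) := hK.2
    rw [hN]
    dsimp only
    rw [h1, ampBipartite_comp, dual_comp, pullback_apply, Matrix.submatrix_apply]
    exact dual_ampBipartite_dephase_apply_eq_zero _ hpq
  · exact kL.ampBipartite.dualHom.comp (hasKraus_pullback _)
  · exact (isTP_dualHom hLu.ampBipartite).comp (isTP_pullback _)
  · exact Fintype.card_congr e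

end Upper

/-! ### The generalized CNOT as a permutation of basis labels -/

section Cnot

variable (d : ℕ) [NeZero d]

/-- The permutation of basis labels `(i, j) ↦ (i, i + j)`. -/
def cnotEquiv : Fin d × Fin d ≃ Fin d × Fin d :=
  Equiv.prodShear (Equiv.refl _) fun i => Equiv.addLeft i

theorem cnotEquiv_apply (x : Fin d × Fin d) : cnotEquiv d x = (x.1, x.1 + x.2) := rfl

theorem cnot_apply (x y : Fin d × Fin d) : cnot d x y = if x = cnotEquiv d y then 1 else 0 := by
  rw [cnot, Matrix.sum_apply, Finset.sum_eq_single y.1, Matrix.sum_apply,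
    Finset.sum_eq_single y.2, Matrix.single_apply, cnotEquiv_apply]
  · simp [eq_comm]
  · intro j _ hj
    rw [Matrix.single_apply, if_neg]
    exact fun h => hj (congrArg Prod.snd h.2)
  · simp
  · intro i _ hi
    rw [Matrix.sum_apply]
    refine Finset.sum_eq_zero fun j _ => ?_
    rw [Matrix.single_apply, if_neg]
    exact fun h => hi (congrArg Prod.fst h.2)
  · simp

theorem cnotAdjoint_eq_pullback : cnotAdjoint d = pullback (cnotEquiv d) := by
  ext1 X
  ext x y
  change ((cnot d)ᴴ * X * (cnot d)ᴴᴴ) x y = _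
  rw [Matrix.conjTranspose_conjTranspose, pullback_apply]
  simp [Matrix.mul_apply, cnot_apply]

theorem isUnital_cnotAdjoint : IsUnital (cnotAdjoint d) := by
  rw [cnotAdjoint_eq_pullback, IsUnital, pullback_apply]
  simp

theorem isDIO_cnotAdjoint : IsDIO (cnotAdjoint d) := by
  rw [cnotAdjoint_eq_pullback]
  refine ⟨⟨(hasKraus_pullback _).isCP, isTP_pullback _⟩, LinearMap.ext fun X => ?_⟩
  simp only [LinearMap.comp_apply, dephase_apply, pullback_apply, Matrix.submatrix_apply,
    Matrix.diagonal_apply_eq]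

theorem isDIO_id {m : Type} [Fintype m] [DecidableEq m] : IsDIO (LinearMap.id : SuperOp m m) := by
  refine ⟨⟨hasKraus_id.isCP, fun X => rfl⟩, LinearMap.ext fun X => ?_⟩
  simp only [LinearMap.comp_apply, dephase_apply, LinearMap.id_apply, Matrix.diagonal_apply_eq]

end Cnot

/-! ### Lower bound: the CNOT realization attains the cohering power -/

section Lower

variable {d : ℕ} [NeZero d]

/-- The channel `Δ ∘ E ∘ U†` whose entangling power realizes the cohering power of `E`. -/
abbrev cnotRealization (E : SuperOp (Fin d) (Fin d)) :
    SuperOp (Fin d × Fin d) (Fin d × Fin d) :=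
  dephase (Fin d × Fin d) ∘ₗ ampRight E (Fin d) ∘ₗ cnotAdjoint d

theorem cnotRealization_apply_diag (E : SuperOp (Fin d) (Fin d)) (X : Op (Fin d × Fin d))
    (i j : Fin d) : cnotRealization E X (i, j) (i, j) =
      E (Matrix.of fun k l => X (k, k + j) (l, l + j)) i i := by
  rw [cnotRealization, cnotAdjoint_eq_pullback, LinearMap.comp_apply, dephase_apply,
    Matrix.diagonal_apply_eq]
  rfl

theorem hasKraus_cnotRealization {E : SuperOp (Fin d) (Fin d)} (hE : HasKraus E) :
    HasKraus (cnotRealization E) :=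
  hasKraus_dephase.comp (hE.ampRight.comp (hasKraus_conjBy _))

/-- The embedding of the label `a` into the support of the maximally correlated operators with
shift `j`. -/
def shiftPair (j a : Fin d) : Fin d × Fin d := (a, a + j)

/-- The CNOT adjoint spreads the effect of `E` over the span of the `|a, a + j⟩`, and compressing to
this span recovers it. `trace_dual_cnotRealization` adds that no weight lies outside the span. -/
theorem pullback_dual_cnotRealization (E : SuperOp (Fin d) (Fin d)) (i j : Fin d) :
    pullback (shiftPair j) (dual (cnotRealization E) (Matrix.single (i, j) (i, j) 1)) =
      dual E (Matrix.single i i 1) := by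
  ext a b
  rw [pullback_apply, Matrix.submatrix_apply, dual_single_apply, dual_single_apply,
    cnotRealization_apply_diag]
  refine congrFun (congrFun (congrArg E ?_) i) i
  ext k l
  simp only [Matrix.of_apply, Matrix.single_apply, shiftPair, Prod.mk.injEq]
  congr 1
  refine propext ⟨fun h => ⟨h.1.1, h.2.1⟩, ?_⟩
  rintro ⟨rfl, rfl⟩
  exact ⟨⟨rfl, rfl⟩, rfl, rfl⟩

theorem trace_dual_cnotRealization (E : SuperOp (Fin d) (Fin d)) (i j : Fin d) :
    (dual (cnotRealization E) (Matrix.single (i, j) (i, j) 1)).trace =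
      (dual E (Matrix.single i i 1)).trace := by
  rw [trace_dual, trace_dual, Matrix.trace_single_mul, Matrix.trace_single_mul, one_smul, one_smul,
    cnotRealization_apply_diag]
  refine congrFun (congrFun (congrArg E ?_) i) i
  ext k l
  by_cases h : k = l <;> simp [Matrix.one_apply, h]

/-- Transition weights of the detection-incoherent channel induced by a bipartite channel `F`. -/
def inducedWeight (F : SuperOp (Fin d × Fin d) (Fin d × Fin d)) (a i : Fin d) : ℝ :=
  1 / (d : ℝ) * ∑ j, ∑ b, transition F (a, b) (i, j)

/-- The weights describe `F` with `B` maximally mixed at the input and discarded at the output; the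
factor `1 / d` is the maximally mixed weight. -/
theorem isStochastic_inducedWeight {F : SuperOp (Fin d × Fin d) (Fin d × Fin d)} (hTP : IsTP F)
    (hpos : ∀ x, (dual F (Matrix.single x x 1)).PosSemidef) : IsStochastic (inducedWeight F) := by
  have hd : (d : ℝ) ≠ 0 := Nat.cast_ne_zero.2 (NeZero.ne d)
  constructor
  · intro a i
    refine mul_nonneg (by positivity) (Finset.sum_nonneg fun j _ => Finset.sum_nonneg fun b _ => ?_)
    rw [transition, ← dual_single_apply]
    exact (Complex.le_def.1 (hpos _).diag_nonneg).1
  · intro a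
    have h : ∀ b, ∑ i, ∑ j, transition F (a, b) (i, j) = 1 := by
      intro b
      have := congrArg Complex.re (hTP (Matrix.single (a, b) (a, b) 1))
      rw [Matrix.trace, Complex.re_sum, Fintype.sum_prod_type] at this
      simpa [transition] using this
    simp only [inducedWeight]
    rw [← Finset.mul_sum]
    have h2 : ∑ i, ∑ j, ∑ b, transition F (a, b) (i, j) = ∑ b : Fin d, (1 : ℝ) := by
      simp_rw [Finset.sum_comm (s := (Finset.univ : Finset (Fin d))) (f := fun j b =>
        transition F (a, b) (_, j))]
      rw [Finset.sum_comm]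
      exact Finset.sum_congr rfl fun b _ => h b
    rw [h2]
    simp [hd]

/-- On the span of the `|a, a + j⟩` the operator `tr_B Y ⊗ 1` is diagonal, since `a + j = a' + j`
forces `a = a'`. Averaging over `j` gives exactly the effects of the classical channel, and the
reduction criterion gives the sign. -/
theorem posSemidef_inducedWeight_sub {F : SuperOp (Fin d × Fin d) (Fin d × Fin d)}
    (hpos : ∀ x, (dual F (Matrix.single x x 1)).PosSemidef)
    (hred : ∀ x, (traceOutRight (dual F (Matrix.single x x 1)) -
      dual F (Matrix.single x x 1)).PosSemidef) (i : Fin d) :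
    (dual (classicalMap (inducedWeight F)) (Matrix.single i i 1) -
      ∑ j, ((1 / Fintype.card (Fin d) : ℝ) : ℂ) •
        pullback (shiftPair j) (dual F (Matrix.single (i, j) (i, j) 1))).PosSemidef := by
  have hre : ∀ a b j, dual F (Matrix.single (i, j) (i, j) 1) (a, b) (a, b) =
      (transition F (a, b) (i, j) : ℂ) := fun a b j => by
    have h := Complex.le_def.1 ((hpos (i, j)).diag_nonneg (i := (a, b)))
    rw [dual_single_apply] at h ⊢
    exact Complex.ext rfl (by simpa using h.2.symm)
  have h : dual (classicalMap (inducedWeight F)) (Matrix.single i i 1) =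
      ∑ j, ((1 / Fintype.card (Fin d) : ℝ) : ℂ) •
        pullback (shiftPair j) (traceOutRight (dual F (Matrix.single (i, j) (i, j) 1))) := by
    rw [dual_classicalMap_single]
    ext a a'
    simp only [Matrix.diagonal_apply, Matrix.sum_apply, Matrix.smul_apply, pullback_apply,
      Matrix.submatrix_apply, traceOutRight, Matrix.of_apply, shiftPair, add_left_inj]
    split_ifs with haa
    · subst haa
      simp [hre, inducedWeight, Finset.mul_sum]
    · simp
  rw [h, ← Finset.sum_sub_distrib]
  refine Matrix.posSemidef_sum _ fun j _ => ?_
  rw [← smul_sub, ← map_sub]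
  exact ((hred (i, j)).submatrix _).smul (Complex.zero_le_real.2 (by positivity))

/-- One-dimensional ancillas only relabel the basis. Positivity is assumed rather than derived from
Kraus forms, as for limits of LOCC channels only the properties in `IsClosureLOCC.props` are at
hand. -/
theorem sum_relEntropy_ampBipartite_trivial {A B : Type} [Fintype A] [Fintype B] [DecidableEq A]
    [DecidableEq B] {Φ Ψ : SuperOp (A × B) (A × B)}
    (hΦ : ∀ x, (dual (ampBipartite Φ (Fin 1) (Fin 1)) (Matrix.single x x 1)).PosSemidef)
    (hΨ : ∀ x, (dual (ampBipartite Ψ (Fin 1) (Fin 1)) (Matrix.single x x 1)).PosSemidef) :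
    ∑ x, relEntropy (dual Φ (Matrix.single x x 1)) (dual Ψ (Matrix.single x x 1)) ≤
      ∑ x, relEntropy (dual (ampBipartite Φ (Fin 1) (Fin 1)) (Matrix.single x x 1))
        (dual (ampBipartite Ψ (Fin 1) (Fin 1)) (Matrix.single x x 1)) := by
  let e : A × B ≃ (A × Fin 1) × (B × Fin 1) :=
    Equiv.prodCongr (Equiv.prodUnique A (Fin 1)).symm (Equiv.prodUnique B (Fin 1)).symm
  rw [← e.sum_comp]
  refine Finset.sum_le_sum fun x _ => ?_
  have hd : ∀ {Φ : SuperOp (A × B) (A × B)}, dual Φ (Matrix.single x x 1) =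
      pullback e (dual (ampBipartite Φ (Fin 1) (Fin 1)) (Matrix.single (e x) (e x) 1)) := by
    intro Φ
    ext a b
    rw [pullback_apply, Matrix.submatrix_apply, dual_single_apply, dual_single_apply]
    refine congrFun (congrFun (congrArg Φ ?_) x) x
    ext k l
    change _ = Matrix.single (e b) (e a) (1 : ℂ) (e k) (e l)
    simp [Matrix.single_apply]
  rw [hd, hd]
  exact relEntropy_pullback_le (hΦ _) (hΨ _) e

/-- For each `i` the `d` shifts give an average with weights `1 / d`; with the factor `1 / d` of
`basisRelEntropy` this matches the normalization `1 / d²` on `AB`. -/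
theorem basisRelEntropy_le_of_isClosureLOCC {E : SuperOp (Fin d) (Fin d)} (hE : HasKraus E)
    {F : SuperOp (Fin d × Fin d) (Fin d × Fin d)}
    (hpos : ∀ x, (dual F (Matrix.single x x 1)).PosSemidef)
    (hred : ∀ x, (traceOutRight (dual F (Matrix.single x x 1)) -
      dual F (Matrix.single x x 1)).PosSemidef) :
    basisRelEntropy E (classicalMap (inducedWeight F)) ≤
      ((1 / (Fintype.card (Fin d × Fin d) : ℝ) : ℝ) : EReal) *
        ∑ x, relEntropy (dual (cnotRealization E) (Matrix.single x x 1))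
          (dual F (Matrix.single x x 1)) := by
  have hd : (0 : ℝ) < d := Nat.cast_pos.2 (NeZero.pos d)
  by_cases hs : ∀ x, SuppLE (dual (cnotRealization E) (Matrix.single x x 1))
      (dual F (Matrix.single x x 1))
  swap
  · rw [sum_relEntropy_eq_top (not_forall.1 hs), EReal.coe_mul_top_of_pos
      (by simp only [Fintype.card_prod, Fintype.card_fin, Nat.cast_mul]; positivity)]
    exact le_top
  have hmain := fun i => relEnt_le_of_pullback (fun j => shiftPair (d := d) j)
    (fun j a b hab => (Prod.ext_iff.1 hab).1)
    (X := fun j => dual (cnotRealization E) (Matrix.single (i, j) (i, j) 1))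
    (Y := fun j => dual F (Matrix.single (i, j) (i, j) 1))
    (fun j => (hasKraus_cnotRealization hE).dual_posSemidef (posSemidef_single _))
    (fun j => hpos _) (fun j => pullback_dual_cnotRealization E i j)
    (fun j => trace_dual_cnotRealization E i j) (posSemidef_inducedWeight_sub hpos hred i)
    fun j => hs _
  rw [basisRelEntropy, sum_relEntropy_of_suppLE fun i => (hmain i).1,
    sum_relEntropy_of_suppLE hs, ← EReal.coe_mul, ← EReal.coe_mul, EReal.coe_le_coe_iff]
  refine (mul_le_mul_of_nonneg_left (Finset.sum_le_sum fun i _ => (hmain i).2)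
    (by positivity)).trans_eq ?_
  simp only [← Finset.mul_sum, Fintype.card_prod, Fintype.card_fin, Fintype.sum_prod_type]
  push_cast
  field_simp

theorem coheringPower_le_entanglingPower {E : SuperOp (Fin d) (Fin d)} (hE : IsChannel E) :
    coheringPower E ≤ entanglingPower (cnotRealization E) := by
  refine le_iInf₂ fun F hF => ?_
  have kE := hE.1.hasKraus
  obtain ⟨hTP, hprops⟩ := hF.props
  have hpos := fun x => (hprops x).1
  have hP := isStochastic_inducedWeight hTP hpos
  refine iInf₂_le_of_le _ (isDIO_classicalMap hP) ?_
  -- Incoherent measurements are diagonal, in particular block-diagonal over `A`, so the basis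
  -- measurement bounds them all.
  have hleft : (⨆ (k : ℕ) (_ : 1 ≤ k) (r : ℕ) (M : Fin r → Op (Fin d × Fin k))
      (_ : IsIncoherentMeas M), measRelEntropy (preprocess M (ampRight E (Fin k)))
        (preprocess M (ampRight (classicalMap (inducedWeight F)) (Fin k)))) ≤
      basisRelEntropy E (classicalMap (inducedWeight F)) := by
    refine iSup_le fun k => iSup_le fun hk => iSup_le fun r => iSup_le fun M => iSup_le fun hM => ?_
    have : Nonempty (Fin k) := ⟨⟨0, hk⟩⟩
    refine measRelEntropy_le_basisRelEntropy kE (hasKraus_classicalMap hP.1) hM.1 ?_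
      (Θ := LinearMap.id) hasKraus_id (fun X => rfl) rfl
    intro x p q hpq
    rw [← hM.2 x, dephase_apply, Matrix.diagonal_apply_ne _ fun h => hpq (congrArg Prod.fst h)]
  refine hleft.trans ((basisRelEntropy_le_of_isClosureLOCC kE hpos fun x => (hprops x).2).trans ?_)
  let e := (Fintype.equivFin ((Fin d × Fin 1) × (Fin d × Fin 1))).symm
  -- Trivial ancillas and the product basis measurement, which is LOCC, already reach the required
  -- value.
  refine le_iSup_of_le 1 (le_iSup_of_le le_rfl (le_iSup_of_le 1 (le_iSup_of_le le_rfl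
    (le_iSup_of_le _ (le_iSup_of_le _ (le_iSup_of_le (subset_closure (isLOCCMeas_single e)) ?_))))))
  rw [measRelEntropy_single]
  have hcard : Fintype.card ((Fin d × Fin 1) × (Fin d × Fin 1)) = Fintype.card (Fin d × Fin d) := by
    simp
  rw [hcard]
  refine mul_le_mul_of_nonneg_left (sum_relEntropy_ampBipartite_trivial (fun x => ?_)
    fun x => ?_) (by positivity)
  · exact (hasKraus_cnotRealization kE).ampBipartite.dual_posSemidef (posSemidef_single x)
  · have h : dual (ampBipartite F (Fin 1) (Fin 1)) (Matrix.single x x 1) =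
        pullback (fun p : (Fin d × Fin 1) × (Fin d × Fin 1) => (p.1.1, p.2.1))
          (dual F (Matrix.single (x.1.1, x.2.1) (x.1.1, x.2.1) 1)) := by
      ext p q
      rw [pullback_apply, Matrix.submatrix_apply, dual_single_apply, dual_single_apply]
      refine congrFun (congrFun (congrArg F ?_) _) _
      ext k l
      simp only [Matrix.of_apply, Matrix.single_apply]
      congr 1
      simp [Prod.ext_iff, Subsingleton.elim (α := Fin 1) _ 0]
    rw [h]
    exact (hpos _).submatrix _

end Lower

end MeasRes

end

open MeasRes
theorem theorem4 (d : ℕ) [NeZero d] (E : SuperOp (Fin d) (Fin d)) (hE : IsChannel E) :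
    entanglingPower
        (dephase (Fin d × Fin d) ∘ₗ ampRight E (Fin d) ∘ₗ cnotAdjoint d) = coheringPower E ∧
      IsDIO (cnotAdjoint d) ∧ IsUnital (cnotAdjoint d) ∧
      IsGreatest
        {v : EReal | ∃ K L : SuperOp (Fin d × Fin d) (Fin d × Fin d),
          IsDIO K ∧ IsDIO L ∧ IsUnital L ∧
            v = entanglingPower
              (dephase (Fin d × Fin d) ∘ₗ K ∘ₗ ampRight E (Fin d) ∘ₗ L)}
        (coheringPower E) := by
  have hU := isDIO_cnotAdjoint d
  have hUu := isUnital_cnotAdjoint d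
  have heq : entanglingPower (cnotRealization E) = coheringPower E :=
    le_antisymm (entanglingPower_le_coheringPower hE (K := LinearMap.id) isDIO_id hU hUu)
      (coheringPower_le_entanglingPower hE)
  refine ⟨heq, hU, hUu, ⟨LinearMap.id, cnotAdjoint d, isDIO_id, hU, hUu, heq.symm⟩, ?_⟩
  rintro v ⟨K, L, hK, hL, hLu, rfl⟩
  exact entanglingPower_le_coheringPower hE hK hL hLu
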